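/- Let $H\ge 2$, let $\mathcal S,\mathcal A$ be finite nonempty sets with $S=|\mathcal S|$, $A=|\mathcal A|$, and consider a finite-horizon MDP with stages $h=0,\dots,H-1$, transition kernels $P_h^*(\cdot\mid s,a)$ on $\mathcal S$, known rewards $r_h:\mathcal S\times\mathcal A\to[0,1]$ and a fixed initial state $s_0$. For a deterministic Markov policy $\pi=(\pi_h)_h$, $\pi_h:\mathcal S\to\mathcal A$, let $V_h^\pi(s)=\mathbb E_{\pi}\big[\sum_{t=h}^{H-1}r_t(s_t,a_t)\mid s_h=s\big]$, and put $V_h^*(s)=\max_\pi V_h^\pi(s)$ (so $V_H^*\equiv0$), $Q_h^*(s,a)=r_h(s,a)+\sum_{s'}P_h^*(s'\mid s,a)V_{h+1}^*(s')$, $\mathcal A_h^*(s)=\arg\max_a Q_h^*(s,a)$. Let $\pi^*$ be any optimal policy ($V_h^{\pi^*}=V_h^*$ for all $h$) and $$\mathrm{gap}^*=\min_{s,h,\;a\notin\mathcal A_h^*(s)}\big(Q_h^*(s,\pi_h^*(s))-Q_h^*(s,a)\big)$$ (with $1/\mathrm{gap}^*:=0$ if every action is optimal everywhere). Fix $\alpha,\gamma\in[0,1]$,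 $\mu>0$ and a number $K$ of episodes. The UCBVI algorithm works as follows. In episode $k=0,\dots,K-1$, let $n_h^k(s,a,s')$ be the number of earlier episodes $i<k$ with $(s_h^i,a_h^i,s_{h+1}^i)=(s,a,s')$, let $n_h^k(s,a)=\sum_{s'}n_h^k(s,a,s')$, and let $\hat P_h^k(s'\mid s,a)=n_h^k(s,a,s')/n_h^k(s,a)$ if $n_h^k(s,a)\ge1$ and $\hat P_h^k(s'\mid s,a)=1/S$ otherwise. Set $V_H^k\equiv0$ and, for $h=H-1,\dots,0$, $$Q_h^k(s,a)=\min\Big\{r_h(s,a)+\sum_{s'}\hat P_h^k(s'\mid s,a)V_{h+1}^k(s')+b_h^k(n_h^k(s,a)),\;H-h\Big\},\qquad V_h^k(s)=\max_a Q_h^k(s,a),$$ where $b_h^k(0)=\infty$ and, for $n\ge1$, $b_h^k(n)=(H-h-1)\sqrt{(0.5\,S\ln2+\mu K^\alpha)/n}$ in the $K$-dependent version and $b_h^k(n)=(H-h-1)\sqrt{(0.5\,S\ln2+\mu(k+1)^\alpha)/n}$ in the $K$-independent version. The learner commits to a policy $\pi^k$ with $\pi_h^k(s)\in\arg\max_aQ_h^k(s,a)$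 for all $h,s$ (ties broken arbitrarily, possibly depending on the past and at random) and then rolls it out from $s_0$ under $P^*$: $a_h^k=\pi_h^k(s_h^k)$, $s_{h+1}^k\sim P_h^*(\cdot\mid s_h^k,a_h^k)$. Let $R_K=\sum_{k=0}^{K-1}\big(V_0^{\pi^*}(s_0)-V_0^{\pi^k}(s_0)\big)$. Then, for both versions of the algorithm, $$\mathbb E[R_K]\;\le\;m_K+H\lceil K^\gamma\rceil+2H^2\big(K-\lceil K^\gamma\rceil\big)\,\delta_K,$$ where $$m_K=\frac{4H^2(H-1)(2H-1)SA\,(S\ln2+2\mu K^\alpha)}{3\,\mathrm{gap}^*},\qquad \delta_K=\begin{cases}SAH\,K\exp(-2\mu K^\alpha)&(K\text{-dependent}),\\ SAH\,K\exp(-2\mu K^{\gamma\alpha})&(K\text{-independent}).\end{cases}$$ -/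

import Mathlib

namespace UCBVI

/-- Expectation of a real function on a finite outcome space under a probability mass function.
The outcome space is finite, so the sum is a finite sum. -/
noncomputable def expect {Ω : Type*} [Finite Ω] (p : PMF Ω) (f : Ω → ℝ) : ℝ :=
  ∑' ω, (p ω).toReal * f ω

/-- A tabular finite-horizon MDP with stages `0, …, H - 1`, rewards in `[0, 1]` and a fixed
initial state. The transition out of the last stage `H - 1` produces a state `s_H` that carries no
reward and no value (the value function at stage `H` is zero), so that kernel has no influence. -/
structure MDP (S A : Type*) (H : ℕ) where
  /-- transition kernel `P_h^*(· ∣ s, a)` -/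
  P : Fin H → S → A → PMF S
  /-- reward `r_h(s, a)` -/
  r : Fin H → S → A → ℝ
  r_mem : ∀ h s a, r h s a ∈ Set.Icc (0 : ℝ) 1
  /-- initial state -/
  s0 : S

/-- Deterministic Markov policies. -/
abbrev Policy (S A : Type*) (H : ℕ) : Type _ := Fin H → S → A

/-- State trajectories `(s_0, …, s_H)` of one episode. -/
abbrev Traj (S : Type*) (H : ℕ) : Type _ := Fin (H + 1) → S

/-- The record of one episode: the policy committed to, and the states observed. The actions are
`a_h = π_h(s_h)`. -/
abbrev Episode (S A : Type*) (H : ℕ) : Type _ := Policy S A H × Traj S H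

/-- The two exploration-bonus schedules. -/
inductive Schedule
  /-- the bonus depends on the total number `K` of episodes -/
  | KDependent
  /-- the bonus depends only on the index of the current episode -/
  | KIndependent

section Model

variable {S A : Type*} {H : ℕ}

/-- The law of the states visited from stage `h` on, when the policy `π` is followed from state `s`
at stage `h`: `s_h = s` and `s_{t+1} ∼ P_t^*(· ∣ s_t, π_t(s_t))` for `t = h, …, H - 1`.
The coordinates before `h` of the trajectory are dummies. -/
noncomputable def MDP.pathLaw (M : MDP S A H) (π : Policy S A H) :
    Fin (H + 1) → S → PMF (Traj S H) :=
  Fin.reverseInduction (motive := fun _ => S → PMF (Traj S H))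
    (fun s => PMF.pure (fun _ => s))
    (fun h next s =>
      (M.P h s (π h s)).bind fun s' => (next s').map fun x => Function.update x h.castSucc s)

variable [Fintype S] [Fintype A]

/-- `V_h^π(s)`: the expected sum of the rewards from stage `h` on, given `s_h = s`. -/
noncomputable def MDP.V (M : MDP S A H) (π : Policy S A H) (h : Fin (H + 1)) (s : S) : ℝ :=
  expect (M.pathLaw π h s) fun x =>
    ∑ t : Fin H, if h ≤ t.castSucc then M.r t (x t.castSucc) (π t (x t.castSucc)) else 0

/-- The optimal value function `V_h^*(s) = max_π V_h^π(s)`. -/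
noncomputable def MDP.Vstar (M : MDP S A H) (h : Fin (H + 1)) (s : S) : ℝ :=
  ⨆ π : Policy S A H, M.V π h s

/-- The optimal action-value function `Q_h^*(s, a)`. -/
noncomputable def MDP.Qstar (M : MDP S A H) (h : Fin H) (s : S) (a : A) : ℝ :=
  M.r h s a + ∑ s', (M.P h s a s').toReal * M.Vstar h.succ s'

/-- The set `𝒜_h^*(s)` of optimal actions. -/
def MDP.optActions (M : MDP S A H) (h : Fin H) (s : S) : Set A :=
  {a | ∀ a', M.Qstar h s a' ≤ M.Qstar h s a}

/-- Optimal policies: those that attain the optimal value at every stage and state. -/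
def MDP.IsOptimal (M : MDP S A H) (π : Policy S A H) : Prop :=
  ∀ h s, M.V π h s = M.Vstar h s

/-- The global `Q^*`-gap: the minimum of `Q_h^*(s, π_h^*(s)) - Q_h^*(s, a)` over all stages, states
and non-optimal actions, where `πs` is an optimal policy. (If no non-optimal action exists, this is
the infimum of an empty set, and the quotient by the gap below is `0`, as it is for the convention
that the gap is then infinite.) -/
noncomputable def MDP.gap (M : MDP S A H) (πs : Policy S A H) : ℝ :=
  sInf {x | ∃ (h : Fin H) (s : S) (a : A),
    a ∉ M.optActions h s ∧ x = M.Qstar h s (πs h s) - M.Qstar h s a}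

/-- The bonus `b_h^k(n)`, with `b_h^k(0) = ∞`. -/
noncomputable def bonus (S : Type*) [Fintype S] (H : ℕ) (sch : Schedule) (μ α : ℝ) (K k : ℕ)
    (h : Fin H) (n : ℕ) : EReal :=
  if n = 0 then ⊤
  else
    ((((H : ℝ) - (h : ℕ) - 1) *
      √((0.5 * (Fintype.card S : ℝ) * Real.log 2 +
        μ * (match sch with
          | .KDependent => (K : ℝ) ^ α
          | .KIndependent => ((k : ℝ) + 1) ^ α)) / (n : ℝ)) : ℝ) : EReal)

open Classical in
/-- `n_h^k(s, a, s')`: the number of the `k` past episodes with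
`(s_h, a_h, s_{h+1}) = (s, a, s')`. -/
noncomputable def transCount {k : ℕ} (hist : Fin k → Episode S A H) (h : Fin H) (s : S) (a : A)
    (s' : S) : ℕ :=
  ∑ i : Fin k, if (hist i).2 h.castSucc = s ∧ (hist i).1 h ((hist i).2 h.castSucc) = a ∧
    (hist i).2 h.succ = s' then 1 else 0

/-- `n_h^k(s, a) = ∑_{s'} n_h^k(s, a, s')`. -/
noncomputable def visitCount {k : ℕ} (hist : Fin k → Episode S A H) (h : Fin H) (s : S) (a : A) :
    ℕ :=
  ∑ s', transCount hist h s a s'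

/-- The empirical transition kernel, uniform at state-action pairs that were not visited. -/
noncomputable def empP {k : ℕ} (hist : Fin k → Episode S A H) (h : Fin H) (s : S) (a : A)
    (s' : S) : ℝ :=
  if visitCount hist h s a = 0 then 1 / (Fintype.card S : ℝ)
  else (transCount hist h s a s' : ℝ) / (visitCount hist h s a : ℝ)

/-- One step of optimistic planning: given the next-stage value `W`, the number
`min {r_h(s, a) + ∑_{s'} P̂_h^k(s' ∣ s, a) W(s') + b_h(n_h^k(s, a)), H - h}`. -/
noncomputable def planQ (M : MDP S A H) (b : Fin H → ℕ → EReal) {k : ℕ}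
    (hist : Fin k → Episode S A H) (h : Fin H) (W : S → ℝ) (s : S) (a : A) : ℝ :=
  (min (((M.r h s a + ∑ s', empP hist h s a s' * W s' : ℝ) : EReal) + b h (visitCount hist h s a))
    (((H : ℝ) - (h : ℕ) : ℝ) : EReal)).toReal

/-- The optimistic value function `V_h^k`: it is zero at stage `H`, and
`V_h^k(s) = max_a Q_h^k(s, a)`. -/
noncomputable def optV (M : MDP S A H) (b : Fin H → ℕ → EReal) {k : ℕ}
    (hist : Fin k → Episode S A H) : Fin (H + 1) → S → ℝ :=
  Fin.reverseInduction (motive := fun _ => S → ℝ) (fun _ => 0)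
    (fun h W s => ⨆ a : A, planQ M b hist h W s a)

/-- The optimistic action-value function `Q_h^k`. -/
noncomputable def optQ (M : MDP S A H) (b : Fin H → ℕ → EReal) {k : ℕ}
    (hist : Fin k → Episode S A H) (h : Fin H) (s : S) (a : A) : ℝ :=
  planQ M b hist h (optV M b hist h.succ) s a

/-- `π` is greedy for `Q^k`: `π_h(s) ∈ argmax_a Q_h^k(s, a)` for all `h` and `s`. -/
def IsGreedy (M : MDP S A H) (b : Fin H → ℕ → EReal) {k : ℕ}
    (hist : Fin k → Episode S A H) (π : Policy S A H) : Prop :=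
  ∀ h s a, optQ M b hist h s a ≤ optQ M b hist h s (π h s)

/-- A learner: it commits to a (possibly randomly chosen) policy on the basis of the past
episodes. -/
abbrev Learner (S A : Type*) (H : ℕ) : Type _ :=
  (k : ℕ) → (Fin k → Episode S A H) → PMF (Policy S A H)

/-- The learner runs the optimistic algorithm for `K` episodes: in each episode it plays some greedy
policy, where ties are broken in an arbitrary, possibly random and history-dependent, way. -/
def IsUCBVI (M : MDP S A H) (sch : Schedule) (μ α : ℝ) (K : ℕ) (L : Learner S A H) : Prop :=
  ∀ k < K, ∀ (hist : Fin k → Episode S A H), ∀ π ∈ (L k hist).support,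
    IsGreedy M (bonus S H sch μ α K k) hist π

/-- The law of the first `k` episodes: in each episode, the learner commits to a policy, which is
then rolled out from the initial state under the true kernel. -/
noncomputable def runLaw (M : MDP S A H) (L : Learner S A H) :
    (k : ℕ) → PMF (Fin k → Episode S A H)
  | 0 => PMF.pure Fin.elim0
  | k + 1 => (runLaw M L k).bind fun hist => (L k hist).bind fun π =>
      (M.pathLaw π 0 M.s0).map fun x =>
        Fin.snoc (α := fun _ => Episode S A H) hist (π, x)

/-- The cumulative regret `R_K` of a realized run of `K` episodes. -/
noncomputable def regret (M : MDP S A H) (πs : Policy S A H) {K : ℕ}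
    (run : Fin K → Episode S A H) : ℝ :=
  ∑ k : Fin K, (M.V πs 0 M.s0 - M.V (run k).1 0 M.s0)

/-- The expected cumulative regret `E[R_K]`. -/
noncomputable def expectedRegret (M : MDP S A H) (πs : Policy S A H) (L : Learner S A H) (K : ℕ) :
    ℝ :=
  expect (runLaw M L K) (regret M πs)

/-- The instance-dependent level `m_K`. -/
noncomputable def mK (M : MDP S A H) (πs : Policy S A H) (μ α : ℝ) (K : ℕ) : ℝ :=
  4 * (H : ℝ) ^ 2 * ((H : ℝ) - 1) * (2 * (H : ℝ) - 1) * (Fintype.card S : ℝ) *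
    (Fintype.card A : ℝ) * ((Fintype.card S : ℝ) * Real.log 2 + 2 * μ * (K : ℝ) ^ α) /
    (3 * M.gap πs)

/-- The residual probability `δ_K`. -/
noncomputable def deltaK (S A : Type*) [Fintype S] [Fintype A] (H : ℕ) (sch : Schedule)
    (μ α γ : ℝ) (K : ℕ) : ℝ :=
  (Fintype.card S : ℝ) * (Fintype.card A : ℝ) * (H : ℝ) *
    (match sch with
      | .KDependent => (K : ℝ) * Real.exp (-2 * μ * (K : ℝ) ^ α)
      | .KIndependent => (K : ℝ) * Real.exp (-2 * μ * (K : ℝ) ^ (γ * α)))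

end Model

end UCBVI

namespace UCBVI

/-! With high probability the empirical kernels are so close to the true ones, uniformly over sets
of next states, that planning is optimistic: `Vstar ≤ optV`. The uniform estimate comes from an
exponential supermartingale (`expect_exp_deviation_le_one`) and a union bound; the `2 ^ S` subsets
are paid for by the term `0.5 S ln 2` of the bonus. The regret of a greedy policy is then at most
the expected sum of the surpluses along its own trajectory, each surplus being twice the bonus, or
the full horizon at an unvisited pair.

The gap enters through clipping (`Vstar_sub_V_le_clipped`): a policy playing a suboptimal action
loses at least `gap`, so discarding `gap / (2 H)` from the surplus at each stage costs only a factor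
`2`. Since the surplus decays like `1 / √n`, its clipped sum over all visits to one pair is bounded
independently of `K`, of order `c / gap` at confidence level `c`. Summing over pairs and stages
gives `mK` as leading term.

The first `⌈K^γ⌉` episodes and the failure events are charged `H` per episode. The first visits are
absorbed by a negative lower-order term once `√c ≥ 3/2`. If `c` is smaller, then either `δ_K` is so
large or `K` so small that the trivial bound `H K` suffices. -/

theorem sum_toReal_eq_one {Ω : Type*} [Fintype Ω] (p : PMF Ω) : ∑ ω, (p ω).toReal = 1 := by
  rw [← ENNReal.toReal_sum (fun ω _ => p.apply_ne_top ω),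
    ← tsum_fintype (L := .unconditional Ω), p.tsum_coe, ENNReal.toReal_one]

/-! ### Finite expectations. -/

section Expect

variable {Ω Ω' : Type*} [Finite Ω] [Finite Ω']

theorem expect_eq_sum [Fintype Ω] (p : PMF Ω) (f : Ω → ℝ) :
    expect p f = ∑ ω, (p ω).toReal * f ω := tsum_fintype _

theorem expect_const (p : PMF Ω) (c : ℝ) : expect p (fun _ => c) = c := by
  have := Fintype.ofFinite Ω
  rw [expect_eq_sum, ← Finset.sum_mul, sum_toReal_eq_one, one_mul]

theorem expect_add (p : PMF Ω) (f g : Ω → ℝ) :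
    expect p (fun ω => f ω + g ω) = expect p f + expect p g := by
  have := Fintype.ofFinite Ω
  simp only [expect_eq_sum, mul_add, Finset.sum_add_distrib]

theorem expect_sub (p : PMF Ω) (f g : Ω → ℝ) :
    expect p (fun ω => f ω - g ω) = expect p f - expect p g := by
  have := Fintype.ofFinite Ω
  simp only [expect_eq_sum, mul_sub, Finset.sum_sub_distrib]

theorem expect_const_mul (p : PMF Ω) (c : ℝ) (f : Ω → ℝ) :
    expect p (fun ω => c * f ω) = c * expect p f := by
  have := Fintype.ofFinite Ω
  simp only [expect_eq_sum, Finset.mul_sum]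
  exact Finset.sum_congr rfl fun _ _ => by ring

theorem expect_finset_sum {ι : Type*} (p : PMF Ω) (s : Finset ι) (f : ι → Ω → ℝ) :
    expect p (fun ω => ∑ i ∈ s, f i ω) = ∑ i ∈ s, expect p (f i) := by
  have := Fintype.ofFinite Ω
  simp only [expect_eq_sum, Finset.mul_sum]
  exact Finset.sum_comm

theorem expect_mono_of_support (p : PMF Ω) {f g : Ω → ℝ} (h : ∀ ω ∈ p.support, f ω ≤ g ω) :
    expect p f ≤ expect p g := by
  have := Fintype.ofFinite Ω
  simp only [expect_eq_sum]
  refine Finset.sum_le_sum fun ω _ => ?_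
  by_cases hω : ω ∈ p.support
  · exact mul_le_mul_of_nonneg_left (h ω hω) ENNReal.toReal_nonneg
  · simp [(p.apply_eq_zero_iff ω).2 hω]

theorem expect_mono (p : PMF Ω) {f g : Ω → ℝ} (h : ∀ ω, f ω ≤ g ω) : expect p f ≤ expect p g :=
  expect_mono_of_support p fun ω _ => h ω

theorem expect_congr_of_support (p : PMF Ω) {f g : Ω → ℝ} (h : ∀ ω ∈ p.support, f ω = g ω) :
    expect p f = expect p g :=
  le_antisymm (expect_mono_of_support p fun ω hω => (h ω hω).le)
    (expect_mono_of_support p fun ω hω => (h ω hω).ge)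

theorem expect_pure (a : Ω) (f : Ω → ℝ) : expect (PMF.pure a) f = f a := by
  rw [expect_congr_of_support (g := fun _ => f a), expect_const]
  intro ω hω
  rw [PMF.support_pure, Set.mem_singleton_iff] at hω
  rw [hω]

theorem expect_bind (p : PMF Ω) (q : Ω → PMF Ω') (f : Ω' → ℝ) :
    expect (p.bind q) f = expect p fun ω => expect (q ω) f := by
  have := Fintype.ofFinite Ω
  have := Fintype.ofFinite Ω'
  simp only [expect_eq_sum, PMF.bind_apply, tsum_fintype]
  simp_rw [ENNReal.toReal_sum (fun ω _ => ENNReal.mul_ne_top (p.apply_ne_top ω)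
    ((q ω).apply_ne_top _)), ENNReal.toReal_mul, Finset.sum_mul, Finset.mul_sum]
  rw [Finset.sum_comm]
  exact Finset.sum_congr rfl fun _ _ => Finset.sum_congr rfl fun _ _ => by ring

theorem expect_map (p : PMF Ω) (g : Ω → Ω') (f : Ω' → ℝ) :
    expect (p.map g) f = expect p fun ω => f (g ω) := by
  rw [PMF.map, expect_bind]
  simp only [Function.comp_apply, expect_pure]

end Expect

/-! ### Trajectory laws and backward recursions. -/

section PathLaw

variable {S A : Type*} {H : ℕ} (M : MDP S A H) (π : Policy S A H)

theorem pathLaw_last (s : S) : M.pathLaw π (Fin.last H) s = PMF.pure fun _ => s := by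
  simp [MDP.pathLaw]

theorem pathLaw_castSucc (h : Fin H) (s : S) :
    M.pathLaw π h.castSucc s = (M.P h s (π h s)).bind fun s' =>
      (M.pathLaw π h.succ s').map fun x => Function.update x h.castSucc s := by
  simp [MDP.pathLaw]

theorem apply_of_mem_support_pathLaw (h : Fin (H + 1)) (s : S) {x : Traj S H}
    (hx : x ∈ (M.pathLaw π h s).support) : x h = s := by
  induction h using Fin.reverseInduction with
  | last =>
    rw [pathLaw_last, PMF.support_pure, Set.mem_singleton_iff] at hx
    rw [hx]
  | cast h _ =>
    simp only [pathLaw_castSucc, PMF.mem_support_bind_iff, PMF.mem_support_map_iff] at hx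
    obtain ⟨_, _, y, _, rfl⟩ := hx
    simp

variable [Finite S]

theorem expect_pathLaw_castSucc (h : Fin H) (s : S) (F : Traj S H → ℝ) :
    expect (M.pathLaw π h.castSucc s) F = expect (M.P h s (π h s)) fun s' =>
      expect (M.pathLaw π h.succ s') fun x => F (Function.update x h.castSucc s) := by
  rw [pathLaw_castSucc, expect_bind]
  simp only [expect_map]

/-- If `φ` has conditional expectation at most `1` across the transition out of stage `h`, then so
has its expectation along a trajectory started before. -/
theorem expect_transition_le_one (h : Fin H) (φ : S → S → ℝ)
    (hφ : ∀ s, expect (M.P h s (π h s)) (φ s) ≤ 1) (h₀ : Fin (H + 1)) (hh : h₀ ≤ h.castSucc)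
    (s : S) : expect (M.pathLaw π h₀ s) (fun x => φ (x h.castSucc) (x h.succ)) ≤ 1 := by
  induction h₀ using Fin.reverseInduction generalizing s with
  | last => exact absurd hh (not_le.2 h.castSucc_lt_last)
  | cast i ih =>
    rw [expect_pathLaw_castSucc]
    rcases (Fin.castSucc_le_castSucc_iff.1 hh).eq_or_lt with rfl | hlt
    · refine le_trans (expect_mono _ fun s' => le_of_eq ?_) (hφ s)
      rw [expect_congr_of_support (g := fun _ => φ s s'), expect_const]
      intro x hx
      simp [Function.update_of_ne (Fin.castSucc_lt_succ (i := i)).ne',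
        apply_of_mem_support_pathLaw M π _ _ hx]
    · refine le_trans (expect_mono _ (g := fun _ => 1) fun s' => ?_) (expect_const _ _).le
      have h1 : h.castSucc ≠ i.castSucc := by simpa using hlt.ne'
      have h2 : h.succ ≠ i.castSucc :=
        ((Fin.castSucc_lt_castSucc_iff.2 hlt).trans Fin.castSucc_lt_succ).ne'
      simp only [Function.update_of_ne h1, Function.update_of_ne h2]
      exact ih (by rw [Fin.le_def]; simpa using hlt) s'

/-- Expected sum of the stage costs `g` from stage `h` on, when `π` is followed from `s`. -/
noncomputable def pathValue (g : Fin H → S → ℝ) (h : Fin (H + 1)) (s : S) : ℝ :=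
  expect (M.pathLaw π h s) fun x => ∑ t : Fin H, if h ≤ t.castSucc then g t (x t.castSucc) else 0

theorem pathValue_last (g : Fin H → S → ℝ) (s : S) : pathValue M π g (Fin.last H) s = 0 := by
  have : ∀ t : Fin H, ¬ Fin.last H ≤ t.castSucc := fun t => not_le.2 t.castSucc_lt_last
  simp [pathValue, this, expect_const, -Fin.last_le_iff]

theorem pathValue_castSucc (g : Fin H → S → ℝ) (h : Fin H) (s : S) :
    pathValue M π g h.castSucc s =
      g h s + expect (M.P h s (π h s)) (pathValue M π g h.succ) := by
  rw [pathValue, expect_pathLaw_castSucc, ← expect_const (M.P h s (π h s)) (g h s), ← expect_add]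
  congr 1
  ext s'
  rw [pathValue, ← expect_const (M.pathLaw π h.succ s') (g h s), ← expect_add]
  congr 1
  ext x
  -- Overwriting coordinate `h` affects only the term `t = h`, because later terms read later
  -- coordinates.
  have hsplit : ∀ t : Fin H, (if h.castSucc ≤ t.castSucc then
      g t (Function.update x h.castSucc s t.castSucc) else 0) =
      (if t = h then g h s else 0) + if h.succ ≤ t.castSucc then g t (x t.castSucc) else 0 := by
    intro t
    rcases lt_trichotomy t h with hlt | rfl | hlt
    · have : ¬ h.succ ≤ t.castSucc := by
        simp only [Fin.le_def, Fin.val_succ, Fin.val_castSucc]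
        have := Fin.lt_def.1 hlt
        omega
      simp [hlt.ne, this, not_le.2 hlt]
    · have : ¬ t.succ ≤ t.castSucc := not_le.2 Fin.castSucc_lt_succ
      simp [this]
    · have h1 : h.succ ≤ t.castSucc := by
        simp only [Fin.le_def, Fin.val_succ, Fin.val_castSucc]
        exact hlt
      simp [hlt.ne', hlt.le, h1]
  simp only [hsplit, Finset.sum_add_distrib, Finset.sum_ite_eq', Finset.mem_univ, if_true]

theorem pathValue_zero (g : Fin H → S → ℝ) (s : S) :
    pathValue M π g 0 s = expect (M.pathLaw π 0 s) fun x => ∑ t : Fin H, g t (x t.castSucc) := by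
  simp [pathValue]

end PathLaw

/-! ### The law of a run and its visit counts. -/

section Run

variable {S A : Type*} {H : ℕ} [Finite S] [Finite A] (M : MDP S A H) (L : Learner S A H)

theorem expect_runLaw_zero (F : (Fin 0 → Episode S A H) → ℝ) :
    expect (runLaw M L 0) F = F Fin.elim0 := by
  rw [runLaw, expect_pure]

theorem expect_runLaw_succ (k : ℕ) (F : (Fin (k + 1) → Episode S A H) → ℝ) :
    expect (runLaw M L (k + 1)) F = expect (runLaw M L k) fun hist =>
      expect (L k hist) fun π => expect (M.pathLaw π 0 M.s0) fun x =>
        F (Fin.snoc (α := fun _ => Episode S A H) hist (π, x)) := by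
  rw [runLaw, expect_bind]
  simp only [expect_bind, expect_map]

end Run

section Counts

variable {S A : Type*} {H : ℕ} [Fintype S] {k : ℕ} (hist : Fin k → Episode S A H)
  (h : Fin H) (s : S) (a : A)

omit [Fintype S] in
open Classical in
theorem transCount_snoc (s' : S) (π : Policy S A H) (x : Traj S H) :
    transCount (Fin.snoc (α := fun _ => Episode S A H) hist (π, x)) h s a s' =
      transCount hist h s a s' +
        if x h.castSucc = s ∧ π h (x h.castSucc) = a ∧ x h.succ = s' then 1 else 0 := by
  simp only [transCount, Fin.sum_univ_castSucc, Fin.snoc_castSucc, Fin.snoc_last]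

open Classical in
theorem visitCount_snoc (π : Policy S A H) (x : Traj S H) :
    visitCount (Fin.snoc (α := fun _ => Episode S A H) hist (π, x)) h s a =
      visitCount hist h s a + if x h.castSucc = s ∧ π h (x h.castSucc) = a then 1 else 0 := by
  simp only [visitCount, transCount_snoc, Finset.sum_add_distrib]
  congr 1
  by_cases hv : x h.castSucc = s ∧ π h (x h.castSucc) = a
  · simp only [hv.1] at hv ⊢
    simp [hv.2]
  · have : ∀ s', ¬ (x h.castSucc = s ∧ π h (x h.castSucc) = a ∧ x h.succ = s') :=
      fun s' hs' => hv ⟨hs'.1, hs'.2.1⟩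
    simp [hv, this]

theorem visitCount_le : visitCount hist h s a ≤ k := by
  classical
  simp only [visitCount, transCount]
  rw [Finset.sum_comm]
  calc _ ≤ ∑ _i : Fin k, 1 := Finset.sum_le_sum fun i _ => ?_
    _ = k := by simp
  calc _ ≤ ∑ s', (if (hist i).2 h.succ = s' then 1 else 0) :=
        Finset.sum_le_sum fun s' _ => by split_ifs <;> simp_all
    _ = 1 := by simp

theorem sum_empP [Nonempty S] : ∑ s', empP hist h s a s' = 1 := by
  unfold empP
  split_ifs with h0
  · simp
  · rw [← Finset.sum_div, ← Nat.cast_sum]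
    exact div_self (by exact_mod_cast h0)

theorem empP_nonneg (s' : S) : 0 ≤ empP hist h s a s' := by
  unfold empP
  split_ifs <;> positivity

end Counts

/-- Hoeffding's lemma for the indicator of a set of outcomes. -/
theorem expect_exp_indicator_le {S : Type*} [Fintype S] [DecidableEq S] (p : PMF S) (B : Finset S)
    (l : ℝ) :
    expect p (fun s => Real.exp (l * ((if s ∈ B then 1 else 0) - ∑ s' ∈ B, (p s').toReal))) ≤
      Real.exp (l ^ 2 / 8) := by
  let _ : MeasurableSpace S := ⊤
  have hsum : ∀ f : S → ℝ, ∫ s, f s ∂p.toMeasure = expect p f := fun f => by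
    rw [PMF.integral_eq_sum, expect_eq_sum]
    simp
  have key := (ProbabilityTheory.hasSubgaussianMGF_of_mem_Icc (μ := p.toMeasure)
    (X := fun s => if s ∈ B then (1 : ℝ) else 0) (a := 0) (b := 1)
    (measurable_from_top.aemeasurable)
    (Filter.Eventually.of_forall fun s => by split_ifs <;> simp)).mgf_le l
  rw [ProbabilityTheory.mgf, hsum, hsum] at key
  have hmean : expect p (fun s => if s ∈ B then (1 : ℝ) else 0) = ∑ s' ∈ B, (p s').toReal := by
    simp [expect_eq_sum]
  rw [hmean] at key
  refine key.trans (Real.exp_le_exp.2 (le_of_eq ?_))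
  norm_num
  ring

/-! ### Concentration of the transition counts. -/

section Deviation

variable {S A : Type*} {H : ℕ} [Fintype S] (M : MDP S A H)

/-- Empirical minus expected number of transitions from `(s, a)` at stage `h` into `B`. -/
noncomputable def deviation {k : ℕ} (hist : Fin k → Episode S A H) (h : Fin H) (s : S) (a : A)
    (B : Finset S) : ℝ :=
  ∑ s' ∈ B, (transCount hist h s a s' : ℝ) -
    visitCount hist h s a * ∑ s' ∈ B, (M.P h s a s').toReal

open Classical in
theorem deviation_snoc {k : ℕ} (hist : Fin k → Episode S A H) (h : Fin H) (s : S) (a : A)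
    (B : Finset S) (π : Policy S A H) (x : Traj S H) :
    deviation M (Fin.snoc (α := fun _ => Episode S A H) hist (π, x)) h s a B =
      deviation M hist h s a B + if x h.castSucc = s ∧ π h (x h.castSucc) = a then
        (if x h.succ ∈ B then 1 else 0) - ∑ s' ∈ B, (M.P h s a s').toReal else 0 := by
  simp only [deviation, visitCount_snoc, transCount_snoc, Nat.cast_add, Finset.sum_add_distrib]
  by_cases hv : x h.castSucc = s ∧ π h (x h.castSucc) = a
  · have : ∀ s', (x h.castSucc = s ∧ π h (x h.castSucc) = a ∧ x h.succ = s') ↔ x h.succ = s' :=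
      fun s' => ⟨fun hs => hs.2.2, fun hs => ⟨hv.1, hv.2, hs⟩⟩
    simp only [this, if_pos hv, Nat.cast_ite, Nat.cast_one, Nat.cast_zero, Finset.sum_ite_eq]
    ring
  · have : ∀ s', ¬ (x h.castSucc = s ∧ π h (x h.castSucc) = a ∧ x h.succ = s') :=
      fun s' hs' => hv ⟨hs'.1, hs'.2.1⟩
    simp [hv, this]

variable [Finite A] (L : Learner S A H)

/-- The exponential supermartingale of the transition counts. -/
theorem expect_exp_deviation_le_one (h : Fin H) (s : S) (a : A) (B : Finset S) (l : ℝ) (k : ℕ) :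
    expect (runLaw M L k) (fun hist =>
      Real.exp (l * deviation M hist h s a B - l ^ 2 / 8 * visitCount hist h s a)) ≤ 1 := by
  classical
  induction k with
  | zero => simp [expect_runLaw_zero, deviation, visitCount, transCount]
  | succ k ih =>
    rw [expect_runLaw_succ]
    refine le_trans (expect_mono _ fun hist => ?_) ih
    refine le_trans (expect_mono _ (g := fun _ => _) fun π => ?_) (expect_const _ _).le
    -- The factor by which one new episode multiplies the exponential; it is `1` when the pair is
    -- not visited, and otherwise Hoeffding's lemma bounds its conditional mean by `1`.
    set φ : S → S → ℝ := fun y y' => Real.exp (if y = s ∧ π h y = a then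
      l * ((if y' ∈ B then 1 else 0) - ∑ s' ∈ B, (M.P h s a s').toReal) - l ^ 2 / 8 else 0) with hφ
    have hstep : ∀ y, expect (M.P h y (π h y)) (φ y) ≤ 1 := by
      intro y
      by_cases hy : y = s ∧ π h y = a
      · obtain ⟨rfl, rfl⟩ := hy
        simp only [hφ, and_self, if_true, sub_eq_neg_add, Real.exp_add _ (_ * _), expect_const_mul]
        have := expect_exp_indicator_le (M.P h y (π h y)) B l
        simp only [sub_eq_neg_add] at this
        calc _ ≤ Real.exp (-(l ^ 2 / 8)) * Real.exp (l ^ 2 / 8) :=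
              mul_le_mul_of_nonneg_left this (Real.exp_pos _).le
          _ = 1 := by rw [← Real.exp_add, neg_add_cancel, Real.exp_zero]
      · simp [hφ, hy, expect_const]
    have key := expect_transition_le_one M π h φ hstep 0 (Fin.zero_le _) M.s0
    calc _ = expect (M.pathLaw π 0 M.s0) (fun x =>
          Real.exp (l * deviation M hist h s a B - l ^ 2 / 8 * visitCount hist h s a) *
            φ (x h.castSucc) (x h.succ)) := by
          congr 1
          ext x
          rw [deviation_snoc, visitCount_snoc, hφ, ← Real.exp_add]
          congr 1
          push_cast
          split_ifs <;> ring
      _ ≤ _ := by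
          rw [expect_const_mul]
          exact mul_le_of_le_one_right (Real.exp_pos _).le key

-- Chernoff's bound with the optimal parameter `l = 4 ρ`: on the event, the exponent is at least `4
-- n ρ² - 2 n ρ² = 2 n ρ²`. Fixing the value `n` of the random count inside the event makes the
-- exponent deterministic; the values of `n` are united later.
open Classical in
theorem expect_deviation_tail_le (h : Fin H) (s : S) (a : A) (B : Finset S) (n k : ℕ) {ρ : ℝ}
    (hρ : 0 ≤ ρ) :
    expect (runLaw M L k) (fun hist =>
      if visitCount hist h s a = n ∧ n * ρ < deviation M hist h s a B then 1 else 0) ≤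
      Real.exp (-2 * n * ρ ^ 2) := by
  calc _ ≤ expect (runLaw M L k) (fun hist => Real.exp (-2 * n * ρ ^ 2) * Real.exp
        ((4 * ρ) * deviation M hist h s a B - (4 * ρ) ^ 2 / 8 * visitCount hist h s a)) := by
        refine expect_mono _ fun hist => ?_
        split_ifs with hc
        · rw [← Real.exp_add, hc.1]
          refine Real.one_le_exp ?_
          nlinarith [mul_le_mul_of_nonneg_left hc.2.le hρ]
        · positivity
    _ ≤ _ := by
        rw [expect_const_mul]
        exact mul_le_of_le_one_right (Real.exp_pos _).le
          (expect_exp_deviation_le_one M L h s a B _ k)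

/-- Every empirical transition probability of a set exceeds the true one by at most `√(c / n)`. -/
def IsConcentrated {k : ℕ} (hist : Fin k → Episode S A H) (c : ℝ) : Prop :=
  ∀ h s a B, deviation M hist h s a B ≤
    visitCount hist h s a * √(c / visitCount hist h s a)

-- Union bound over stages, pairs, subsets and the possible counts `1, …, k`; with `ρ = √(c / n)`
-- every tail is `exp (-2 c)`, whatever `n` is.
open Classical in
theorem expect_not_isConcentrated_le [Fintype A] {c : ℝ} (hc : 0 ≤ c) (k : ℕ) :
    expect (runLaw M L k) (fun hist => if IsConcentrated M hist c then 0 else 1) ≤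
      Fintype.card S * Fintype.card A * H * k * (2 ^ Fintype.card S * Real.exp (-2 * c)) := by
  calc _ ≤ expect (runLaw M L k) (fun hist => ∑ i : Fin H × S × A × Finset S,
        ∑ n ∈ Finset.Icc 1 k, if visitCount hist i.1 i.2.1 i.2.2.1 = n ∧
          n * √(c / n) < deviation M hist i.1 i.2.1 i.2.2.1 i.2.2.2 then (1 : ℝ) else 0) := by
        refine expect_mono _ fun hist => ?_
        have h0 : ∀ (i : Fin H × S × A × Finset S), ∀ n ∈ Finset.Icc 1 k, 0 ≤
            (if visitCount hist i.1 i.2.1 i.2.2.1 = n ∧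
            n * √(c / n) < deviation M hist i.1 i.2.1 i.2.2.1 i.2.2.2 then (1 : ℝ) else 0) :=
          fun i n _ => by split_ifs <;> norm_num
        split_ifs with hcon
        · exact Finset.sum_nonneg fun i _ => Finset.sum_nonneg (h0 i)
        · simp only [IsConcentrated, not_forall, not_le] at hcon
          obtain ⟨h, s, a, B, hlt⟩ := hcon
          -- With no visits the deviation is zero, so a violation needs a positive count.
          have hne : visitCount hist h s a ≠ 0 := by
            intro hz
            have hz' : ∀ s', transCount hist h s a s' = 0 := by
              simpa [visitCount] using hz
            simp [deviation, hz, hz'] at hlt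
          refine le_trans (le_trans ?_ (Finset.single_le_sum (h0 (h, s, a, B))
            (Finset.mem_Icc.2 ⟨Nat.one_le_iff_ne_zero.2 hne, visitCount_le hist h s a⟩)))
            (Finset.single_le_sum (fun i _ => Finset.sum_nonneg (h0 i))
              (Finset.mem_univ (h, s, a, B)))
          rw [if_pos ⟨rfl, hlt⟩]
    _ ≤ ∑ i : Fin H × S × A × Finset S, ∑ n ∈ Finset.Icc 1 k, Real.exp (-2 * c) := by
        simp only [expect_finset_sum]
        refine Finset.sum_le_sum fun i _ => Finset.sum_le_sum fun n hn => ?_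
        refine (expect_deviation_tail_le M L _ _ _ _ n k (Real.sqrt_nonneg _)).trans
          (le_of_eq ?_)
        have : (n : ℝ) ≠ 0 := by
          have := (Finset.mem_Icc.1 hn).1
          positivity
        rw [Real.sq_sqrt (by positivity)]
        congr 1
        field_simp
    _ = _ := by
        simp
        ring

end Deviation

/-! ### From sets of next states to value functions. -/

section Deviation

variable {S A : Type*} {H : ℕ} [Fintype S] (M : MDP S A H) {k : ℕ}
  {hist : Fin k → Episode S A H} {c C : ℝ} (h : Fin H) (s : S) (a : A) {W : S → ℝ}

/-- For weights in `[0, C]` the sum is largest when the weight is `C` exactly where the empirical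
probability exceeds the true one. As concentration covers every subset, `W` may depend on the
history, as the optimistic values do. -/
theorem sum_empP_sub_mul_le (hG : IsConcentrated M hist c) (hn : visitCount hist h s a ≠ 0)
    (hW : ∀ s', W s' ∈ Set.Icc 0 C) :
    ∑ s', (empP hist h s a s' - (M.P h s a s').toReal) * W s' ≤
      C * √(c / visitCount hist h s a) := by
  classical
  set B := Finset.univ.filter fun s' => 0 ≤ empP hist h s a s' - (M.P h s a s').toReal
  have hC : 0 ≤ C := (hW s).1.trans (hW s).2
  have hn' : (0 : ℝ) < visitCount hist h s a := by positivity
  have hB : ∑ s' ∈ B, (empP hist h s a s' - (M.P h s a s').toReal) ≤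
      √(c / visitCount hist h s a) := by
    have := hG h s a B
    rw [deviation, sub_le_iff_le_add, ← mul_add] at this
    simp only [empP, hn, if_false, Finset.sum_sub_distrib, ← Finset.sum_div]
    rw [sub_le_iff_le_add, div_le_iff₀ hn']
    linarith
  calc _ ≤ ∑ s', if s' ∈ B then C * (empP hist h s a s' - (M.P h s a s').toReal) else 0 := by
        refine Finset.sum_le_sum fun s' _ => ?_
        by_cases hs : 0 ≤ empP hist h s a s' - (M.P h s a s').toReal
        · have : s' ∈ B := Finset.mem_filter.2 ⟨Finset.mem_univ _, hs⟩
          rw [if_pos this, mul_comm]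
          exact mul_le_mul_of_nonneg_right (hW s').2 hs
        · have : s' ∉ B := by simpa [B] using hs
          rw [if_neg this]
          exact mul_nonpos_of_nonpos_of_nonneg (not_le.1 hs).le (hW s').1
    _ = C * ∑ s' ∈ B, (empP hist h s a s' - (M.P h s a s').toReal) := by
        rw [Finset.mul_sum, Finset.sum_ite_mem, Finset.univ_inter]
    _ ≤ _ := mul_le_mul_of_nonneg_left hB hC

/-- On concentrated histories, empirical and true one-step expectations differ by at most
`C * √(c / n)` for functions with values in `[0, C]`. -/
theorem abs_sum_empP_mul_sub_le (hG : IsConcentrated M hist c) (hn : visitCount hist h s a ≠ 0)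
    (hW : ∀ s', W s' ∈ Set.Icc 0 C) :
    |∑ s', empP hist h s a s' * W s' - ∑ s', (M.P h s a s').toReal * W s'| ≤
      C * √(c / visitCount hist h s a) := by
  have : Nonempty S := ⟨s⟩
  have h1 := sum_empP_sub_mul_le M h s a hG hn hW
  -- Both kernels have mass one, so the one-sided bound for `C - W` is the opposite bound for `W`.
  have h2 := sum_empP_sub_mul_le M h s a hG hn (W := fun s' => C - W s')
    fun s' => ⟨sub_nonneg.2 (hW s').2, sub_le_self _ (hW s').1⟩
  simp only [sub_mul, mul_sub, Finset.sum_sub_distrib, ← Finset.sum_mul, sum_empP,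
    sum_toReal_eq_one] at h1 h2
  rw [abs_le]
  constructor <;> linarith

end Deviation

/-! ### Bellman equations, the gap, and clipping. -/

section Bellman

variable {S A : Type*} {H : ℕ} [Fintype S] [Fintype A] (M : MDP S A H)

omit [Fintype A] in
theorem V_last (π : Policy S A H) (s : S) : M.V π (Fin.last H) s = 0 :=
  pathValue_last M π (fun t s => M.r t s (π t s)) s

omit [Fintype A] in
theorem V_castSucc (π : Policy S A H) (h : Fin H) (s : S) :
    M.V π h.castSucc s = M.r h s (π h s) + expect (M.P h s (π h s)) (M.V π h.succ) :=
  pathValue_castSucc M π (fun t s => M.r t s (π t s)) h s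

omit [Fintype A] in
theorem V_mem_Icc (π : Policy S A H) (h : Fin (H + 1)) (s : S) :
    M.V π h s ∈ Set.Icc (0 : ℝ) (H - (h : ℕ)) := by
  induction h using Fin.reverseInduction generalizing s with
  | last => simp [V_last]
  | cast h ih =>
    rw [V_castSucc]
    have h1 := expect_mono (M.P h s (π h s)) fun s' => (ih s').1
    have h2 := expect_mono (M.P h s (π h s)) fun s' => (ih s').2
    rw [expect_const] at h1 h2
    have h3 := M.r_mem h s (π h s)
    simp only [Fin.val_succ, Nat.cast_add, Nat.cast_one, Fin.val_castSucc] at h2 ⊢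
    exact ⟨add_nonneg h3.1 h1, by linarith [h3.2]⟩

omit [Fintype A] in
theorem V_congr {π π' : Policy S A H} (h : Fin (H + 1))
    (hπ : ∀ t : Fin H, h ≤ t.castSucc → π t = π' t)
    (s : S) : M.V π h s = M.V π' h s := by
  induction h using Fin.reverseInduction generalizing s with
  | last => simp [V_last]
  | cast h ih =>
    rw [V_castSucc, V_castSucc, hπ h le_rfl]
    congr 2
    ext s'
    exact ih (fun t ht => hπ t (Fin.castSucc_lt_succ.le.trans ht)) s'

theorem V_le_Vstar (π : Policy S A H) (h : Fin (H + 1)) (s : S) : M.V π h s ≤ M.Vstar h s := by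
  classical
  exact le_ciSup (f := fun π => M.V π h s) (Set.finite_range _).bddAbove π

omit [Fintype A] in
theorem Qstar_eq (h : Fin H) (s : S) (a : A) :
    M.Qstar h s a = M.r h s a + expect (M.P h s a) (M.Vstar h.succ) := by
  rw [MDP.Qstar, expect_eq_sum]

variable {M} {πs : Policy S A H} (hπs : M.IsOptimal πs)
include hπs

omit [Fintype A] in
theorem Vstar_mem_Icc (h : Fin (H + 1)) (s : S) : M.Vstar h s ∈ Set.Icc (0 : ℝ) (H - (h : ℕ)) := by
  rw [← hπs h s]
  exact V_mem_Icc M πs h s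

omit [Fintype A] in
theorem Qstar_apply_self (h : Fin H) (s : S) : M.Qstar h s (πs h s) = M.Vstar h.castSucc s := by
  rw [Qstar_eq, ← hπs, V_castSucc]
  congr 2
  ext s'
  rw [hπs]

/-- `Qstar` is attained by the policy that plays `a` at stage `h` and follows `πs` afterwards. -/
theorem Qstar_le_Vstar (h : Fin H) (s : S) (a : A) : M.Qstar h s a ≤ M.Vstar h.castSucc s := by
  classical
  refine le_trans (le_of_eq ?_) (V_le_Vstar M (Function.update πs h fun _ => a) h.castSucc s)
  rw [Qstar_eq, V_castSucc]
  simp only [Function.update_self]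
  congr 2
  ext s'
  rw [← hπs]
  refine V_congr M _ (fun t ht => ?_) s'
  rw [Function.update_of_ne]
  rintro rfl
  exact absurd ht (not_le.2 Fin.castSucc_lt_succ)

omit [Fintype A] in
theorem Qstar_nonneg (h : Fin H) (s : S) (a : A) : 0 ≤ M.Qstar h s a := by
  rw [Qstar_eq]
  have := expect_mono (M.P h s a) fun s' => (Vstar_mem_Icc hπs h.succ s').1
  rw [expect_const] at this
  exact add_nonneg (M.r_mem h s a).1 this

theorem Qstar_eq_Vstar {h : Fin H} {s : S} {a : A} (ha : a ∈ M.optActions h s) :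
    M.Qstar h s a = M.Vstar h.castSucc s :=
  le_antisymm (Qstar_le_Vstar hπs h s a) ((Qstar_apply_self hπs h s).ge.trans (ha _))

theorem Qstar_lt_Vstar {h : Fin H} {s : S} {a : A} (ha : a ∉ M.optActions h s) :
    M.Qstar h s a < M.Vstar h.castSucc s := by
  simp only [MDP.optActions, Set.mem_ofPred_eq, not_forall, not_le] at ha
  obtain ⟨a', ha'⟩ := ha
  exact ha'.trans_le (Qstar_le_Vstar hπs h s a')

theorem gap_le {h : Fin H} {s : S} {a : A} (ha : a ∉ M.optActions h s) :
    M.gap πs ≤ M.Vstar h.castSucc s - M.Qstar h s a := by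
  refine csInf_le ⟨0, ?_⟩ ⟨h, s, a, ha, by rw [Qstar_apply_self hπs]⟩
  rintro _ ⟨h, s, a, _, rfl⟩
  rw [Qstar_apply_self hπs]
  exact sub_nonneg.2 (Qstar_le_Vstar hπs h s a)

theorem gap_pos (hne : ∃ h s a, a ∉ M.optActions h s) : 0 < M.gap πs := by
  have hfin : {x | ∃ (h : Fin H) (s : S) (a : A),
      a ∉ M.optActions h s ∧ x = M.Qstar h s (πs h s) - M.Qstar h s a}.Finite := by
    refine (Set.finite_range fun i : Fin H × S × A =>
      M.Qstar i.1 i.2.1 (πs i.1 i.2.1) - M.Qstar i.1 i.2.1 i.2.2).subset ?_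
    rintro _ ⟨h, s, a, _, rfl⟩
    exact ⟨(h, s, a), rfl⟩
  obtain ⟨h, s, a, ha⟩ := hne
  obtain ⟨h', s', a', ha', he⟩ := Set.Nonempty.csInf_mem
    (Set.nonempty_of_mem (by exact ⟨h, s, a, ha, rfl⟩)) hfin
  rw [MDP.gap, he, Qstar_apply_self hπs]
  exact sub_pos.2 (Qstar_lt_Vstar hπs ha')

theorem gap_le_horizon (hne : ∃ h s a, a ∉ M.optActions h s) : M.gap πs ≤ H := by
  obtain ⟨h, s, a, ha⟩ := hne
  have h1 := (Vstar_mem_Icc hπs h.castSucc s).2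
  have h2 : (0 : ℝ) ≤ (h.castSucc : ℕ) := Nat.cast_nonneg _
  linarith [gap_le hπs ha, Qstar_nonneg hπs h s a]

theorem V_eq_Vstar_of_forall_optimal (hopt : ∀ h s a, a ∈ M.optActions h s) (π : Policy S A H)
    (h : Fin (H + 1)) (s : S) : M.V π h s = M.Vstar h s := by
  induction h using Fin.reverseInduction generalizing s with
  | last => rw [V_last, ← hπs, V_last]
  | cast h ih =>
    rw [V_castSucc, ← Qstar_eq_Vstar hπs (hopt h s (π h s)), Qstar_eq]
    congr 2
    ext s'
    exact ih s'

/-- If the suboptimality of `π` is bounded by expected sums of `g`, then it is bounded by twice the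
expected sums of `g` clipped at `gap / (2 H)`. -/
theorem Vstar_sub_V_le_clipped (π : Policy S A H) (g : Fin H → S → ℝ)
    (hg : ∀ h s, M.Vstar h s - M.V π h s ≤ pathValue M π g h s) (h : Fin (H + 1)) (s : S) :
    M.Vstar h s - M.V π h s ≤
      pathValue M π (fun t s => 2 * max 0 (g t s - M.gap πs / (2 * H))) h s := by
  set ε := M.gap πs / (2 * H) with hε
  set W := pathValue M π (fun t s => 2 * max 0 (g t s - ε)) with hW
  -- Clipping loses at most `ε` at each of the remaining `H - h` stages.
  have hlow : ∀ h s, 2 * (pathValue M π g h s - (H - (h : ℕ)) * ε) ≤ W h s := by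
    intro h s
    induction h using Fin.reverseInduction generalizing s with
    | last => simp [hW, pathValue_last]
    | cast h ih =>
      have := expect_mono (M.P h s (π h s)) ih
      simp only [mul_sub, expect_sub, expect_const_mul, expect_const] at this
      rw [hW, pathValue_castSucc, pathValue_castSucc, ← hW]
      simp only [Fin.val_succ, Nat.cast_add, Nat.cast_one, Fin.val_castSucc] at this ⊢
      linarith [le_max_right 0 (g h s - ε)]
  induction h using Fin.reverseInduction generalizing s with
  | last => rw [hW, pathValue_last, ← hπs, V_last, V_last, sub_zero]
  | cast h ih =>
    by_cases ha : π h s ∈ M.optActions h s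
    -- An optimal action loses nothing at this stage: the whole loss comes from the next one.
    · rw [hW, pathValue_castSucc, ← hW, ← Qstar_eq_Vstar hπs ha, Qstar_eq, V_castSucc]
      have := expect_mono (M.P h s (π h s)) ih
      simp only [expect_sub] at this
      linarith [le_max_left 0 (g h s - ε)]
    -- A suboptimal action makes the loss `Δ` at least `gap = 2 H ε`, so `2 (Δ - H ε) ≥ Δ`.
    · have h1 := gap_le hπs ha
      have h2 : M.V π h.castSucc s ≤ M.Qstar h s (π h s) := by
        rw [V_castSucc, Qstar_eq]
        exact add_le_add_right (expect_mono _ fun s' => V_le_Vstar M π _ s') _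
      have h3 := hg h.castSucc s
      refine le_trans ?_ (hlow h.castSucc s)
      have hH : (0 : ℝ) < H := by exact_mod_cast h.pos
      have hgap : M.gap πs = 2 * (H * ε) := by rw [hε]; field_simp
      have hεn : 0 ≤ ε := div_nonneg (gap_pos hπs ⟨h, s, _, ha⟩).le (by positivity)
      have : (H - ((h.castSucc : ℕ) : ℝ)) * ε ≤ H * ε :=
        mul_le_mul_of_nonneg_right (sub_le_self _ (Nat.cast_nonneg _)) hεn
      linarith

end Bellman

/-! ### Optimism and the surplus. -/

section Planning

variable {S A : Type*} {H : ℕ} [Fintype S] [Fintype A] (M : MDP S A H)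
  {b : Fin H → ℕ → EReal} {k : ℕ} (hist : Fin k → Episode S A H)

omit [Fintype A] in
theorem optV_last (s : S) : optV M b hist (Fin.last H) s = 0 := by
  simp [optV]

omit [Fintype A] in
theorem optV_castSucc (h : Fin H) (s : S) :
    optV M b hist h.castSucc s = ⨆ a, optQ M b hist h s a := by
  simp [optV, optQ]

theorem optQ_le_optV (h : Fin H) (s : S) (a : A) :
    optQ M b hist h s a ≤ optV M b hist h.castSucc s := by
  rw [optV_castSucc]
  exact le_ciSup (Set.finite_range _).bddAbove a

theorem IsGreedy.optV_eq {M : MDP S A H} {hist : Fin k → Episode S A H} {π : Policy S A H}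
    (hπ : IsGreedy M b hist π) (h : Fin H) (s : S) :
    optV M b hist h.castSucc s = optQ M b hist h s (π h s) := by
  refine le_antisymm ?_ (optQ_le_optV M hist h s _)
  have : Nonempty A := ⟨π h s⟩
  rw [optV_castSucc]
  exact ciSup_le (hπ h s)

omit [Fintype A] in
theorem optQ_of_bonus_top {h : Fin H} {s : S} {a : A}
    (hb : b h (visitCount hist h s a) = ⊤) : optQ M b hist h s a = H - (h : ℕ) := by
  rw [optQ, planQ, hb, EReal.coe_add_top, min_eq_right le_top, EReal.toReal_coe]

omit [Fintype A] in
theorem optQ_of_bonus_coe {h : Fin H} {s : S} {a : A} {x : ℝ}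
    (hb : b h (visitCount hist h s a) = x) : optQ M b hist h s a =
      min (M.r h s a + ∑ s', empP hist h s a s' * optV M b hist h.succ s' + x) (H - (h : ℕ)) := by
  rw [optQ, planQ, hb, ← EReal.coe_add, ← EReal.coe_strictMono.monotone.map_min, EReal.toReal_coe]

/-- The standard bonus with confidence level `c`. -/
noncomputable def levelBonus (H : ℕ) (c : ℝ) (h : Fin H) (n : ℕ) : EReal :=
  if n = 0 then ⊤ else ((((H : ℝ) - (h : ℕ) - 1) * √(c / n) : ℝ) : EReal)

/-- The surplus of the optimistic action value after `n` visits. -/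
noncomputable def surplus (H : ℕ) (c : ℝ) (h : Fin H) (n : ℕ) : ℝ :=
  if n = 0 then (H : ℝ) - (h : ℕ) else 2 * (((H : ℝ) - (h : ℕ) - 1) * √(c / n))

theorem one_le_horizon_sub (h : Fin H) : (1 : ℝ) ≤ H - (h : ℕ) := by
  have : ((h : ℕ) : ℝ) + 1 ≤ H := by exact_mod_cast h.isLt
  linarith

variable {c : ℝ}

theorem optV_mem_Icc [Nonempty A] (h : Fin (H + 1)) (s : S) :
    optV M (levelBonus H c) hist h s ∈ Set.Icc (0 : ℝ) (H - (h : ℕ)) := by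
  induction h using Fin.reverseInduction generalizing s with
  | last => simp [optV_last]
  | cast h ih =>
    have hQ : ∀ a, optQ M (levelBonus H c) hist h s a ∈ Set.Icc (0 : ℝ) (H - (h : ℕ)) := by
      intro a
      have h1 := one_le_horizon_sub h
      by_cases hn : visitCount hist h s a = 0
      · rw [optQ_of_bonus_top (hb := by simp [levelBonus, hn])]
        exact ⟨by linarith, le_rfl⟩
      · rw [optQ_of_bonus_coe (hb := if_neg hn)]
        refine ⟨le_min ?_ (by linarith), min_le_right _ _⟩
        exact add_nonneg (add_nonneg (M.r_mem h s a).1 (Finset.sum_nonneg fun s' _ =>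
          mul_nonneg (empP_nonneg hist h s a s') (ih s').1))
          (mul_nonneg (by linarith) (Real.sqrt_nonneg _))
    rw [optV_castSucc, Fin.val_castSucc]
    obtain ⟨a⟩ := ‹Nonempty A›
    exact ⟨(hQ a).1.trans (le_ciSup (Set.finite_range _).bddAbove a),
      ciSup_le fun a => (hQ a).2⟩

variable {M hist}

/-- Optimism on concentrated histories. -/
theorem IsConcentrated.Vstar_le_optV [Nonempty A] {πs : Policy S A H} (hπs : M.IsOptimal πs)
    (hG : IsConcentrated M hist c) (h : Fin (H + 1)) (s : S) :
    M.Vstar h s ≤ optV M (levelBonus H c) hist h s := by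
  induction h using Fin.reverseInduction generalizing s with
  | last => rw [optV_last, ← hπs, V_last]
  | cast h ih =>
    refine le_trans ?_ (optQ_le_optV M hist h s (πs h s))
    have hle := (Vstar_mem_Icc hπs h.castSucc s).2
    rw [Fin.val_castSucc] at hle
    by_cases hn : visitCount hist h s (πs h s) = 0
    · rw [optQ_of_bonus_top (hb := by simp [levelBonus, hn])]
      exact hle
    · rw [optQ_of_bonus_coe (hb := if_neg hn)]
      refine le_min ?_ hle
      rw [← Qstar_apply_self hπs, MDP.Qstar]
      have h1 := abs_le.1 (abs_sum_empP_mul_sub_le M h s (πs h s) hG hn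
        (Vstar_mem_Icc hπs h.succ))
      have h2 : ∑ s', empP hist h s (πs h s) s' * M.Vstar h.succ s' ≤
          ∑ s', empP hist h s (πs h s) s' * optV M (levelBonus H c) hist h.succ s' :=
        Finset.sum_le_sum fun s' _ => mul_le_mul_of_nonneg_left (ih s') (empP_nonneg _ _ _ _ _)
      simp only [Fin.val_succ, Nat.cast_add, Nat.cast_one, ← sub_sub] at h1
      linarith [h1.1]

/-- At a visited pair the surplus contains the bonus twice: once as added by the algorithm, once as
a bound on the estimation error for `optV` at the next stage. At an unvisited pair the truncation at
`H - h` bounds everything. -/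
theorem IsConcentrated.optV_sub_V_le [Nonempty A] (hG : IsConcentrated M hist c)
    {π : Policy S A H} (hπ : IsGreedy M (levelBonus H c) hist π) (h : Fin (H + 1)) (s : S) :
    optV M (levelBonus H c) hist h s - M.V π h s ≤
      pathValue M π (fun t s => surplus H c t (visitCount hist t s (π t s))) h s := by
  induction h using Fin.reverseInduction generalizing s with
  | last => simp [optV_last, V_last, pathValue_last]
  | cast h ih =>
    rw [hπ.optV_eq, V_castSucc, pathValue_castSucc]
    have h0 := expect_mono (M.P h s (π h s)) ih
    simp only [expect_sub] at h0
    have hV := optV_mem_Icc M hist (c := c) h.succ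
    by_cases hn : visitCount hist h s (π h s) = 0
    · rw [optQ_of_bonus_top (hb := by simp [levelBonus, hn]), surplus, if_pos hn]
      have h1 := expect_mono (M.P h s (π h s)) fun s' => (hV s').1
      rw [expect_const] at h1
      linarith [(M.r_mem h s (π h s)).1]
    · rw [optQ_of_bonus_coe (hb := if_neg hn), surplus, if_neg hn]
      have h1 := abs_le.1 (abs_sum_empP_mul_sub_le M h s (π h s) hG hn hV)
      rw [← expect_eq_sum] at h1
      simp only [Fin.val_succ, Nat.cast_add, Nat.cast_one, ← sub_sub] at h1
      refine (sub_le_sub_right (min_le_left _ _) _).trans ?_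
      linarith [h1.2]

end Planning

/-! ### Sums of clipped surpluses. -/

section Sums

theorem sum_inv_sqrt_le (N : ℕ) :
    ∑ j ∈ Finset.range (N + 1), 1 / √((j : ℝ) + 1) ≤ 2 * √((N : ℝ) + 1) - 1 := by
  induction N with
  | zero => norm_num
  | succ N ih =>
    rw [Finset.sum_range_succ]
    push_cast
    have h0 : (0 : ℝ) ≤ N := Nat.cast_nonneg N
    set u := √((N : ℝ) + 1)
    set v := √((N : ℝ) + 1 + 1)
    have hv : 0 < v := Real.sqrt_pos.2 (by linarith)
    have hu2 : u ^ 2 = N + 1 := Real.sq_sqrt (by linarith)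
    have hv2 : v ^ 2 = N + 1 + 1 := Real.sq_sqrt (by linarith)
    have : 1 / v ≤ 2 * v - 2 * u := by
      rw [div_le_iff₀ hv]
      nlinarith [sq_nonneg (u - v)]
    linarith

/-- The terms decrease, so if the last one is positive none is clipped, and `2 a √n - ε n ≤ a² / ε`
by completing the square. The remaining `-a`, inherited from the `-1` in `sum_inv_sqrt_le`, later
pays for the first visits. -/
theorem sum_clip_div_sqrt_le {a ε : ℝ} (hε : 0 < ε) (ha : ε ≤ a) (N : ℕ) :
    ∑ j ∈ Finset.range N, max 0 (a / √((j : ℝ) + 1) - ε) ≤ a ^ 2 / ε - a := by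
  have ha0 : 0 < a := hε.trans_le ha
  induction N with
  | zero =>
    rw [Finset.sum_range_zero, sub_nonneg, le_div_iff₀ hε, sq]
    exact mul_le_mul_of_nonneg_left ha ha0.le
  | succ N ih =>
    rcases le_or_gt (a / √((N : ℝ) + 1) - ε) 0 with hN | hN
    · rwa [Finset.sum_range_succ, max_eq_left hN, add_zero]
    · have heq : ∀ j ∈ Finset.range (N + 1), max 0 (a / √((j : ℝ) + 1) - ε) =
          a * (1 / √((j : ℝ) + 1)) - ε := by
        intro j hj
        have hj' : (j : ℝ) ≤ N := by exact_mod_cast Nat.lt_succ_iff.1 (Finset.mem_range.1 hj)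
        rw [mul_one_div, max_eq_right]
        refine hN.le.trans (sub_le_sub_right ?_ _)
        exact div_le_div_of_nonneg_left ha0.le (Real.sqrt_pos.2 (by positivity))
          (Real.sqrt_le_sqrt (by linarith))
      rw [Finset.sum_congr rfl heq, Finset.sum_sub_distrib, ← Finset.mul_sum, Finset.sum_const,
        Finset.card_range, nsmul_eq_mul]
      have h1 := mul_le_mul_of_nonneg_left (sum_inv_sqrt_le N) ha0.le
      have h2 : √((N : ℝ) + 1) ^ 2 = N + 1 := Real.sq_sqrt (by positivity)
      have h3 : 2 * a * √((N : ℝ) + 1) - ε * (N + 1) ≤ a ^ 2 / ε := by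
        rw [le_div_iff₀ hε]
        linear_combination sq_nonneg (a - ε * √((N : ℝ) + 1)) + ε ^ 2 * h2
      push_cast
      linarith

theorem sum_horizon_sub (H : ℕ) :
    ∑ h : Fin H, ((H : ℝ) - (h : ℕ)) = H * (H + 1) / 2 := by
  induction H with
  | zero => simp
  | succ n ih =>
    simp only [Fin.sum_univ_succ, Fin.val_zero, Fin.val_succ, Nat.cast_add, Nat.cast_one,
      add_sub_add_right_eq_sub, ih]
    push_cast
    ring

theorem sum_horizon_sub_one (H : ℕ) :
    ∑ h : Fin H, ((H : ℝ) - (h : ℕ) - 1) = H * (H - 1) / 2 := by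
  rw [Finset.sum_sub_distrib, sum_horizon_sub]
  simp
  ring

theorem sum_horizon_sub_one_sq (H : ℕ) :
    ∑ h : Fin H, ((H : ℝ) - (h : ℕ) - 1) ^ 2 = ((H : ℝ) - 1) * H * (2 * H - 1) / 6 := by
  induction H with
  | zero => simp
  | succ n ih =>
    simp only [Fin.sum_univ_succ, Fin.val_zero, Fin.val_succ, Nat.cast_add, Nat.cast_one,
      add_sub_add_right_eq_sub, ih]
    push_cast
    ring

theorem surplus_succ {H : ℕ} {c : ℝ} (hc : 0 ≤ c) (h : Fin H) (j : ℕ) :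
    surplus H c h (j + 1) = 2 * ((H : ℝ) - (h : ℕ) - 1) * √c / √((j : ℝ) + 1) := by
  rw [surplus, if_neg (Nat.succ_ne_zero j), Real.sqrt_div hc]
  push_cast
  ring

theorem surplus_mono {H : ℕ} {c c' : ℝ} (hc : c ≤ c') (h : Fin H) (n : ℕ) :
    surplus H c h n ≤ surplus H c' h n := by
  unfold surplus
  split_ifs
  · rfl
  · have := one_le_horizon_sub h
    have : (0 : ℝ) ≤ H - (h : ℕ) - 1 := by linarith
    gcongr

theorem sum_clip_surplus_le {H : ℕ} {c ε : ℝ} (hε : 0 < ε) (hε1 : ε ≤ 2 * √c) (hc : 0 ≤ c)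
    (h : Fin H) (N : ℕ) :
    ∑ j ∈ Finset.range N, max 0 (surplus H c h j - ε) ≤
      ((H : ℝ) - (h : ℕ)) + (4 * c / ε * ((H : ℝ) - (h : ℕ) - 1) ^ 2 -
        2 * √c * ((H : ℝ) - (h : ℕ) - 1)) := by
  have h1 := one_le_horizon_sub h
  set l : ℝ := (H : ℝ) - (h : ℕ) - 1 with hl
  have hrest : ∀ N, ∑ j ∈ Finset.range N, max 0 (surplus H c h (j + 1) - ε) ≤
      4 * c / ε * l ^ 2 - 2 * √c * l := by
    intro N
    simp only [surplus_succ hc, ← hl]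
    -- Before the last stage `l ≥ 1`, which gives `ε ≤ 2 l √c`; at the last stage the surplus after
    -- a visit is zero.
    rcases Nat.lt_or_ge ((h : ℕ) + 1) H with hh | hh
    · have hl1 : 1 ≤ l := by
        have : ((h : ℕ) : ℝ) + 1 + 1 ≤ H := by exact_mod_cast hh
        linarith
      refine (sum_clip_div_sqrt_le hε (a := 2 * l * √c) ?_ N).trans (le_of_eq ?_)
      · nlinarith [Real.sqrt_nonneg c]
      · rw [mul_pow, Real.sq_sqrt hc]
        ring
    · have hl0 : l = 0 := by
        have : ((h : ℕ) : ℝ) + 1 = H := by exact_mod_cast le_antisymm h.isLt hh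
        linarith
      simp [hl0, hε.le]
  cases N with
  | zero =>
    have := hrest 0
    rw [Finset.sum_range_zero] at this ⊢
    linarith
  | succ N =>
    rw [Finset.sum_range_succ', add_comm]
    refine add_le_add ?_ (hrest N)
    rw [surplus, if_pos rfl]
    exact max_le (by linarith) (by linarith)

end Sums

/-! ### Charging regret to visits. -/

section Potential

variable {S A : Type*} {H : ℕ} [Fintype S] [Fintype A]

/-- Total cost of all visits so far, when the `j`-th visit to a pair at stage `h` costs `f h j`. -/
noncomputable def visitCost (f : Fin H → ℕ → ℝ) {k : ℕ} (hist : Fin k → Episode S A H) : ℝ :=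
  ∑ h : Fin H, ∑ s : S, ∑ a : A, ∑ j ∈ Finset.range (visitCount hist h s a), f h j

theorem visitCost_snoc (f : Fin H → ℕ → ℝ) {k : ℕ} (hist : Fin k → Episode S A H)
    (π : Policy S A H) (x : Traj S H) :
    visitCost f (Fin.snoc (α := fun _ => Episode S A H) hist (π, x)) = visitCost f hist +
      ∑ h : Fin H, f h (visitCount hist h (x h.castSucc) (π h (x h.castSucc))) := by
  classical
  rw [visitCost, visitCost, ← Finset.sum_add_distrib]
  refine Finset.sum_congr rfl fun h _ => ?_
  have hterm : ∀ s a, ∑ j ∈ Finset.range (visitCount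
      (Fin.snoc (α := fun _ => Episode S A H) hist (π, x)) h s a), f h j =
      ∑ j ∈ Finset.range (visitCount hist h s a), f h j +
        if x h.castSucc = s then
          (if π h (x h.castSucc) = a then f h (visitCount hist h s a) else 0) else 0 := by
    intro s a
    rw [visitCount_snoc]
    by_cases hs : x h.castSucc = s
    · subst hs
      by_cases ha : π h (x h.castSucc) = a <;> simp [ha, Finset.sum_range_succ]
    · simp [hs]
  simp only [hterm, Finset.sum_add_distrib, add_right_inj]
  rw [Finset.sum_comm]
  simp

theorem visitCost_le {f : Fin H → ℕ → ℝ} {B : Fin H → ℝ}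
    (hf : ∀ h N, ∑ j ∈ Finset.range N, f h j ≤ B h) {k : ℕ} (hist : Fin k → Episode S A H) :
    visitCost f hist ≤ Fintype.card S * Fintype.card A * ∑ h, B h := by
  calc visitCost f hist ≤ ∑ h : Fin H, ∑ _s : S, ∑ _a : A, B h :=
        Finset.sum_le_sum fun h _ => Finset.sum_le_sum fun s _ => Finset.sum_le_sum fun a _ =>
          hf h _
    _ = _ := by simp [Finset.mul_sum, mul_assoc]

variable (M : MDP S A H) (πs : Policy S A H) (L : Learner S A H)

omit [Fintype A] in
theorem regret_snoc {k : ℕ} (hist : Fin k → Episode S A H) (e : Episode S A H) :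
    regret M πs (Fin.snoc (α := fun _ => Episode S A H) hist e) =
      regret M πs hist + (M.V πs 0 M.s0 - M.V e.1 0 M.s0) := by
  simp only [regret, Fin.sum_univ_castSucc, Fin.snoc_castSucc, Fin.snoc_last]

/-- Counts are frozen during an episode, so the expected path cost of an episode is exactly the
expected increase of `visitCost`, and these increases telescope. The term `d` collects the episodes
without a surplus bound. -/
theorem expectedRegret_le_visitCost (f : Fin H → ℕ → ℝ) (d : (k : ℕ) → (Fin k → Episode S A H) → ℝ)
    (K : ℕ) (hstep : ∀ k < K, ∀ hist : Fin k → Episode S A H, ∀ π ∈ (L k hist).support,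
      M.V πs 0 M.s0 - M.V π 0 M.s0 ≤ d k hist +
        pathValue M π (fun t s => f t (visitCount hist t s (π t s))) 0 M.s0) :
    expectedRegret M πs L K ≤ expect (runLaw M L K) (visitCost f) +
      ∑ k ∈ Finset.range K, expect (runLaw M L k) (d k) := by
  induction K with
  | zero => simp [expectedRegret, expect_runLaw_zero, regret, visitCost, visitCount, transCount]
  | succ K ih =>
    have ih' := ih fun k hk => hstep k (hk.trans K.lt_succ_self)
    rw [expectedRegret] at ih' ⊢
    rw [expect_runLaw_succ, expect_runLaw_succ, Finset.sum_range_succ]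
    simp only [regret_snoc, visitCost_snoc, expect_add, expect_const]
    have hK := expect_mono (runLaw M L K) fun hist =>
      expect_mono_of_support (L K hist) (hstep K K.lt_succ_self hist)
    simp only [expect_add, expect_const] at hK
    have hpv : ∀ (hist : Fin K → Episode S A H) (π : Policy S A H),
        expect (M.pathLaw π 0 M.s0) (fun x => ∑ h : Fin H,
          f h (visitCount hist h (x h.castSucc) (π h (x h.castSucc)))) =
        pathValue M π (fun t s => f t (visitCount hist t s (π t s))) 0 M.s0 := fun hist π =>
      (pathValue_zero M π (fun t s => f t (visitCount hist t s (π t s))) M.s0).symm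
    simp only [hpv]
    linarith

end Potential

/-! ### Confidence levels and the residual probability. -/

section Confidence

variable {S A : Type*} {H : ℕ} [Fintype S]

/-- The confidence level `0.5 S ln 2 + μ x` used by the bonus in episode `k`. -/
noncomputable def confidence (S : Type*) [Fintype S] (sch : Schedule) (μ α : ℝ) (K k : ℕ) : ℝ :=
  0.5 * (Fintype.card S : ℝ) * Real.log 2 +
    μ * (match sch with
      | .KDependent => (K : ℝ) ^ α
      | .KIndependent => ((k : ℝ) + 1) ^ α)

theorem bonus_eq_levelBonus (sch : Schedule) (μ α : ℝ) (K k : ℕ) :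
    bonus S H sch μ α K k = levelBonus H (confidence S sch μ α K k) := by
  cases sch <;> rfl

variable {sch : Schedule} {μ α γ : ℝ} {K k : ℕ}

theorem confidence_nonneg (hμ : 0 ≤ μ) : 0 ≤ confidence S sch μ α K k := by
  have : 0 ≤ Real.log 2 := Real.log_nonneg one_le_two
  cases sch <;> simp only [confidence] <;> positivity

theorem confidence_le (hμ : 0 ≤ μ) (hα : 0 ≤ α) (hk : k < K) :
    confidence S sch μ α K k ≤ 0.5 * (Fintype.card S : ℝ) * Real.log 2 + μ * (K : ℝ) ^ α := by
  have : (k : ℝ) + 1 ≤ K := by exact_mod_cast hk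
  cases sch <;> simp only [confidence] <;> gcongr

variable [Fintype A] (M : MDP S A H) (L : Learner S A H)

open Classical in
theorem expect_not_isConcentrated_le_deltaK (hμ : 0 ≤ μ) (hα : 0 ≤ α) (hk : k < K)
    (hγk : (K : ℝ) ^ γ ≤ k) :
    expect (runLaw M L k) (fun hist =>
      if IsConcentrated M hist (confidence S sch μ α K k) then 0 else 1) ≤
      deltaK S A H sch μ α γ K := by
  refine (expect_not_isConcentrated_le M L (confidence_nonneg hμ) k).trans ?_
  have hkK : (k : ℝ) ≤ K := by exact_mod_cast hk.le
  -- The term `0.5 S ln 2` cancels the number of subsets.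
  have hexp : ∀ x, (2 : ℝ) ^ Fintype.card S *
      Real.exp (-2 * (0.5 * (Fintype.card S : ℝ) * Real.log 2 + μ * x)) =
      Real.exp (-2 * μ * x) := by
    intro x
    rw [← Real.rpow_natCast, Real.rpow_def_of_pos two_pos, ← Real.exp_add]
    congr 1
    ring
  rw [mul_assoc _ (k : ℝ)]
  cases sch <;> simp only [confidence, deltaK, hexp]
  · gcongr
  -- This is what the burn-in is for: once `k ≥ K^γ`, the level of episode `k` is high enough.
  · have hx : (K : ℝ) ^ (γ * α) ≤ ((k : ℝ) + 1) ^ α := by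
      rw [Real.rpow_mul (Nat.cast_nonneg K)]
      exact Real.rpow_le_rpow (by positivity) (by linarith) hα
    have : -2 * μ * ((k : ℝ) + 1) ^ α ≤ -2 * μ * (K : ℝ) ^ (γ * α) := by nlinarith
    gcongr

theorem deltaK_nonneg : 0 ≤ deltaK S A H sch μ α γ K := by
  cases sch <;> simp only [deltaK] <;> positivity

/-- Since `γ ≤ 1`, a small `δ_K` forces `2 μ K^α` to be large in both versions. -/
theorem deltaK_ge (hμ : 0 ≤ μ) (hα : 0 ≤ α) (hγ : γ ≤ 1) (hK : 1 ≤ K) :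
    (Fintype.card S : ℝ) * Fintype.card A * H * (K * Real.exp (-2 * μ * (K : ℝ) ^ α)) ≤
      deltaK S A H sch μ α γ K := by
  have hK' : (1 : ℝ) ≤ K := by exact_mod_cast hK
  cases sch <;> simp only [deltaK]
  · rfl
  · have hx : (K : ℝ) ^ (γ * α) ≤ (K : ℝ) ^ α :=
      Real.rpow_le_rpow_of_exponent_le hK' (mul_le_of_le_one_left hα hγ)
    have : -2 * μ * (K : ℝ) ^ α ≤ -2 * μ * (K : ℝ) ^ (γ * α) := by nlinarith
    gcongr

end Confidence

/-! ### Assembling the regret bound. -/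

section Regret

variable {S A : Type*} {H : ℕ} [Fintype S] [Fintype A] {M : MDP S A H} {πs : Policy S A H}

theorem expectedRegret_le_mul (L : Learner S A H) (K : ℕ) :
    expectedRegret M πs L K ≤ H * K := by
  refine (expect_mono _ (g := fun _ => (H : ℝ) * K) fun run => ?_).trans (expect_const _ _).le
  calc regret M πs run ≤ ∑ _k : Fin K, (H : ℝ) := Finset.sum_le_sum fun k _ => ?_
    _ = H * K := by simp [mul_comm]
  have h1 := (V_mem_Icc M πs 0 M.s0).2
  have h2 := (V_mem_Icc M (run k).1 0 M.s0).1
  simp only [Fin.val_zero, Nat.cast_zero, sub_zero] at h1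
  linarith

theorem expectedRegret_eq_zero (hπs : M.IsOptimal πs) (hopt : ∀ h s a, a ∈ M.optActions h s)
    (L : Learner S A H) (K : ℕ) : expectedRegret M πs L K = 0 := by
  have : regret M πs (K := K) = fun _ => 0 := by
    ext run
    simp [regret, V_eq_Vstar_of_forall_optimal hπs hopt]
  rw [expectedRegret, this, expect_const]

variable {sch : Schedule} {μ α γ : ℝ} {K : ℕ} {L : Learner S A H}

/-- The regret bound in terms of the clipped surplus of all visits. -/
theorem expectedRegret_le_clipped [Nonempty A] (hπs : M.IsOptimal πs) (hμ : 0 ≤ μ) (hα : 0 ≤ α)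
    (hL : IsUCBVI M sch μ α K L) {k₀ : ℕ} (hk₀ : k₀ ≤ K) (hγk₀ : (K : ℝ) ^ γ ≤ k₀) {B : Fin H → ℝ}
    (hB : ∀ h N, ∑ j ∈ Finset.range N,
      max 0 (surplus H (0.5 * (Fintype.card S : ℝ) * Real.log 2 + μ * (K : ℝ) ^ α) h j -
        M.gap πs / (2 * H)) ≤ B h) :
    expectedRegret M πs L K ≤ 2 * (Fintype.card S * Fintype.card A * ∑ h, B h) + H * k₀ +
      H * (K - k₀) * deltaK S A H sch μ α γ K := by
  classical
  set c := 0.5 * (Fintype.card S : ℝ) * Real.log 2 + μ * (K : ℝ) ^ α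
  set ε := M.gap πs / (2 * H)
  have hVbound : ∀ π : Policy S A H, M.V πs 0 M.s0 - M.V π 0 M.s0 ≤ H := by
    intro π
    have h1 := (V_mem_Icc M πs 0 M.s0).2
    have h2 := (V_mem_Icc M π 0 M.s0).1
    simp only [Fin.val_zero, Nat.cast_zero, sub_zero] at h1
    linarith
  set f : Fin H → ℕ → ℝ := fun h n => 2 * max 0 (surplus H c h n - ε)
  have hf0 : ∀ h n, 0 ≤ f h n := fun h n => mul_nonneg zero_le_two (le_max_left _ _)
  -- The full horizon is charged during burn-in and whenever concentration fails.
  set d : (k : ℕ) → (Fin k → Episode S A H) → ℝ := fun k hist =>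
    H * if k < k₀ then 1 else if IsConcentrated M hist (confidence S sch μ α K k) then 0 else 1
  have hstep : ∀ k < K, ∀ hist : Fin k → Episode S A H, ∀ π ∈ (L k hist).support,
      M.V πs 0 M.s0 - M.V π 0 M.s0 ≤ d k hist +
        pathValue M π (fun t s => f t (visitCount hist t s (π t s))) 0 M.s0 := by
    intro k hk hist π hπ
    have hpos : 0 ≤ pathValue M π (fun t s => f t (visitCount hist t s (π t s))) 0 M.s0 := by
      rw [pathValue_zero, ← expect_const (M.pathLaw π 0 M.s0) 0]
      exact expect_mono _ fun x => Finset.sum_nonneg fun t _ => hf0 _ _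
    by_cases hd : d k hist = H
    · rw [hd]
      linarith [hVbound π]
    · have hG : IsConcentrated M hist (confidence S sch μ α K k) := by
        by_contra hG
        exact hd (by simp [d, hG])
      have hgreedy := hL k hk hist π hπ
      rw [bonus_eq_levelBonus] at hgreedy
      have hd0 : 0 ≤ d k hist := by
        simp only [d]
        split_ifs <;> positivity
      rw [hπs 0 M.s0]
      refine (Vstar_sub_V_le_clipped hπs π _ (fun h s => (sub_le_sub_right
        (hG.Vstar_le_optV hπs h s) _).trans (hG.optV_sub_V_le hgreedy h s)) 0 M.s0).trans ?_
      refine le_trans ?_ (le_add_of_nonneg_left hd0)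
      rw [pathValue_zero, pathValue_zero]
      refine expect_mono _ fun x => Finset.sum_le_sum fun t _ => ?_
      -- Replacing the level of episode `k` by the larger final level `c` makes the cost independent
      -- of `k`.
      exact mul_le_mul_of_nonneg_left (max_le_max le_rfl (sub_le_sub_right
        (surplus_mono (confidence_le hμ hα hk) _ _) _)) zero_le_two
  have hcost : expect (runLaw M L K) (visitCost f) ≤
      2 * (Fintype.card S * Fintype.card A * ∑ h, B h) := by
    refine (expect_mono _ fun hist => visitCost_le (B := fun h => 2 * B h) (fun h N => ?_)
      hist).trans (le_of_eq ?_)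
    · rw [← Finset.mul_sum]
      exact mul_le_mul_of_nonneg_left (hB h N) zero_le_two
    · rw [expect_const, ← Finset.mul_sum]
      ring
  have hd : ∑ k ∈ Finset.range K, expect (runLaw M L k) (d k) ≤
      H * k₀ + H * (K - k₀) * deltaK S A H sch μ α γ K := by
    rw [← Finset.sum_range_add_sum_Ico _ hk₀]
    refine add_le_add ?_ ?_
    · calc _ ≤ ∑ k ∈ Finset.range k₀, (H : ℝ) := Finset.sum_le_sum fun k hk => by
            simp [d, Finset.mem_range.1 hk, expect_const]
        _ = H * k₀ := by simp [mul_comm]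
    · calc _ ≤ ∑ k ∈ Finset.Ico k₀ K, H * deltaK S A H sch μ α γ K :=
            Finset.sum_le_sum fun k hk => by
              obtain ⟨hk1, hk2⟩ := Finset.mem_Ico.1 hk
              simp only [d, not_lt.2 hk1, if_false, expect_const_mul]
              refine mul_le_mul_of_nonneg_left ?_ (Nat.cast_nonneg H)
              exact expect_not_isConcentrated_le_deltaK M L hμ hα hk2
                (hγk₀.trans (by exact_mod_cast hk1))
        _ = _ := by
            rw [Finset.sum_const, Nat.card_Ico, nsmul_eq_mul, Nat.cast_sub hk₀]
            ring
  linarith [expectedRegret_le_visitCost M πs L f d K hstep]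

/-- When the confidence level is at least `9 / 4`, the clipped surpluses sum to at most `m_K`. -/
theorem sum_clip_bound_le_mK (hH : 2 ≤ H) {g : ℝ} (hg : g = M.gap πs) {c : ℝ}
    (hc : c = 0.5 * (Fintype.card S : ℝ) * Real.log 2 + μ * (K : ℝ) ^ α) (hc2 : 3 / 2 ≤ √c)
    (hgpos : 0 < g) :
    2 * (Fintype.card S * Fintype.card A * ∑ h : Fin H, (((H : ℝ) - (h : ℕ)) +
      (4 * c / (g / (2 * H)) * ((H : ℝ) - (h : ℕ) - 1) ^ 2 -
        2 * √c * ((H : ℝ) - (h : ℕ) - 1)))) ≤ mK M πs μ α K := by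
  have hH' : (2 : ℝ) ≤ H := by exact_mod_cast hH
  -- First visits cost `H (H + 1) / 2` per pair; `H + 1 ≤ 3 (H - 1)` and `2 √c ≥ 3` let the negative
  -- term absorb them.
  have hlin : (H : ℝ) * (H + 1) / 2 ≤ 2 * √c * (H * (H - 1) / 2) := by
    have : 3 * ((H : ℝ) - 1) ≤ 2 * √c * (H - 1) :=
      mul_le_mul_of_nonneg_right (by linarith) (by linarith)
    nlinarith
  have hm : mK M πs μ α K = 2 * (Fintype.card S * Fintype.card A *
      (4 * c / (g / (2 * H)) * (((H : ℝ) - 1) * H * (2 * H - 1) / 6))) := by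
    rw [mK, hc, ← hg]
    field_simp
    ring
  have hsum : ∀ C D : ℝ, ∑ h : Fin H, (((H : ℝ) - (h : ℕ)) +
      (C * ((H : ℝ) - (h : ℕ) - 1) ^ 2 - D * ((H : ℝ) - (h : ℕ) - 1))) =
      H * (H + 1) / 2 + (C * (((H : ℝ) - 1) * H * (2 * H - 1) / 6) - D * (H * (H - 1) / 2)) := by
    intro C D
    rw [← sum_horizon_sub, ← sum_horizon_sub_one, ← sum_horizon_sub_one_sq, Finset.mul_sum,
      Finset.mul_sum, ← Finset.sum_sub_distrib, ← Finset.sum_add_distrib]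
  rw [hm, hsum]
  gcongr
  linarith

end Regret

/-! ### Numerical bounds for small confidence levels. -/

section Numerics

variable {S A : Type*} {H : ℕ} [Fintype S] [Fintype A] {M : MDP S A H} {πs : Policy S A H}
  {sch : Schedule} {μ α γ : ℝ} {K : ℕ}

theorem mK_nonneg (hH : 2 ≤ H) (hg : 0 ≤ M.gap πs) (hμ : 0 ≤ μ) : 0 ≤ mK M πs μ α K := by
  have hH' : (2 : ℝ) ≤ H := by exact_mod_cast hH
  have h1 : (0 : ℝ) ≤ (H : ℝ) - 1 := by linarith
  have h2 : (0 : ℝ) ≤ 2 * (H : ℝ) - 1 := by linarith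
  have : 0 ≤ Real.log 2 := Real.log_nonneg one_le_two
  unfold mK
  positivity

theorem mul_le_mK (hH : 2 ≤ H) (hS : 1 ≤ Fintype.card S) (hA : 1 ≤ Fintype.card A)
    (hgpos : 0 < M.gap πs) (hgH : M.gap πs ≤ H) {x : ℝ} (hx0 : 0 ≤ x)
    (hx : x ≤ Fintype.card S * Real.log 2 + 2 * μ * (K : ℝ) ^ α) :
    4 * H * x ≤ mK M πs μ α K := by
  have hH' : (2 : ℝ) ≤ H := by exact_mod_cast hH
  have hSA : (1 : ℝ) ≤ Fintype.card S * Fintype.card A := by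
    exact_mod_cast Nat.mul_le_mul hS hA
  have h1 : (3 : ℝ) ≤ (H - 1) * (2 * H - 1) := by nlinarith
  have h3 : 3 ≤ ((H : ℝ) - 1) * (2 * H - 1) * (Fintype.card S * Fintype.card A) := by
    nlinarith
  have h4 : 3 * x ≤ ((H : ℝ) - 1) * (2 * H - 1) * (Fintype.card S * Fintype.card A) *
      (Fintype.card S * Real.log 2 + 2 * μ * (K : ℝ) ^ α) :=
    mul_le_mul h3 hx hx0 (by linarith)
  rw [mK, le_div_iff₀ (by positivity)]
  calc 4 * H * x * (3 * M.gap πs) ≤ 4 * H * x * (3 * H) := by gcongr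
    _ = 4 * (H : ℝ) ^ 2 * (3 * x) := by ring
    _ ≤ 4 * (H : ℝ) ^ 2 * (((H : ℝ) - 1) * (2 * H - 1) * (Fintype.card S * Fintype.card A) *
      (Fintype.card S * Real.log 2 + 2 * μ * (K : ℝ) ^ α)) := by gcongr
    _ = _ := by ring

/-- If the residual probability is small, then the confidence level is logarithmically large. -/
theorem log_le_of_deltaK_lt (hH : 2 ≤ H) (hS : 1 ≤ Fintype.card S) (hA : 1 ≤ Fintype.card A)
    (hK : 1 ≤ K) (hμ : 0 ≤ μ) (hα : 0 ≤ α) (hγ : γ ≤ 1)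
    (hδ : 2 * H * deltaK S A H sch μ α γ K < 1) :
    Real.log (16 * K) ≤ Fintype.card S * Real.log 2 + 2 * μ * (K : ℝ) ^ α := by
  have hH' : (2 : ℝ) ≤ H := by exact_mod_cast hH
  have hK' : (1 : ℝ) ≤ K := by exact_mod_cast hK
  have hS' : (1 : ℝ) ≤ Fintype.card S := by exact_mod_cast hS
  have hSA : (1 : ℝ) ≤ Fintype.card S * Fintype.card A := by
    exact_mod_cast Nat.mul_le_mul hS hA
  have hlow := deltaK_ge (S := S) (A := A) (H := H) (sch := sch) hμ hα hγ hK
  set E := Real.exp (-2 * μ * (K : ℝ) ^ α) with hE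
  have hEpos : 0 < E := Real.exp_pos _
  -- The factor `8` is `2 H · S A H` at `H = 2`, `S = A = 1`; the term `S ln 2 ≥ ln 2` later turns
  -- `8 K` into `16 K`.
  have h8 : 8 * K * E ≤ 1 := by
    have h4 : (8 : ℝ) ≤ 2 * H * (Fintype.card S * Fintype.card A * H) := by
      calc (8 : ℝ) = 2 * 2 * (1 * 2) := by norm_num
        _ ≤ _ := by gcongr
    calc 8 * K * E = 8 * (K * E) := by ring
      _ ≤ 2 * H * (Fintype.card S * Fintype.card A * H) * (K * E) := by gcongr
      _ = 2 * H * (Fintype.card S * Fintype.card A * H * (K * E)) := by ring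
      _ ≤ 2 * H * deltaK S A H sch μ α γ K := by gcongr
      _ ≤ 1 := hδ.le
  have hlog := Real.log_le_log (by positivity) h8
  rw [Real.log_mul (by positivity) hEpos.ne', hE, Real.log_exp, Real.log_one] at hlog
  have h16 : Real.log (16 * K) = Real.log 2 + Real.log (8 * K) := by
    rw [← Real.log_mul two_ne_zero (by positivity)]
    congr 1
    ring
  have := mul_le_mul_of_nonneg_right hS' (Real.log_nonneg one_le_two)
  linarith

end Numerics

end UCBVI

/-! ### Case analysis on `K`, the gap and `δ_K`. -/

theorem theorem2 {S A : Type*} [Fintype S] [Fintype A] [Nonempty A] {H : ℕ} (hH : 2 ≤ H)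
    (M : UCBVI.MDP S A H) (πs : UCBVI.Policy S A H) (hπs : M.IsOptimal πs)
    (sch : UCBVI.Schedule) (μ : ℝ) (hμ : 0 < μ) (α : ℝ) (hα : α ∈ Set.Icc (0 : ℝ) 1)
    (γ : ℝ) (hγ : γ ∈ Set.Icc (0 : ℝ) 1) (K : ℕ)
    (L : UCBVI.Learner S A H) (hL : UCBVI.IsUCBVI M sch μ α K L) :
    UCBVI.expectedRegret M πs L K ≤
      UCBVI.mK M πs μ α K + (H : ℝ) * (⌈(K : ℝ) ^ γ⌉ : ℝ)
        + 2 * (H : ℝ) ^ 2 * ((K : ℝ) - (⌈(K : ℝ) ^ γ⌉ : ℝ))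
          * UCBVI.deltaK S A H sch μ α γ K := by
  open UCBVI in
  have hH' : (2 : ℝ) ≤ H := by exact_mod_cast hH
  have hcast : (⌈(K : ℝ) ^ γ⌉ : ℝ) = (⌈(K : ℝ) ^ γ⌉₊ : ℝ) := by
    rw [← Int.natCast_ceil_eq_ceil (by positivity), Int.cast_natCast]
  rw [hcast]
  set k₀ := ⌈(K : ℝ) ^ γ⌉₊
  have hδ0 : 0 ≤ deltaK S A H sch μ α γ K := deltaK_nonneg
  have hgap0 : 0 ≤ M.gap πs := by
    refine Real.sInf_nonneg ?_
    rintro _ ⟨h, s, a, _, rfl⟩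
    rw [Qstar_apply_self hπs]
    exact sub_nonneg.2 (Qstar_le_Vstar hπs h s a)
  have hm0 : 0 ≤ mK M πs μ α K := mK_nonneg hH hgap0 hμ.le
  rcases Nat.eq_zero_or_pos K with hK0 | hK
  -- For `K = γ = 0` the convention `0 ^ 0 = 1` makes `K - k₀` negative, but it is multiplied by
  -- `δ_K = 0`.
  · have hδ : deltaK S A H sch μ α γ K = 0 := by
      cases sch <;> simp [deltaK, hK0]
    have := expectedRegret_le_mul (M := M) (πs := πs) L K
    rw [hδ, mul_zero, add_zero]
    rw [hK0, Nat.cast_zero, mul_zero, ← hK0] at this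
    have : (0 : ℝ) ≤ H * k₀ := by positivity
    linarith
  have hK' : (1 : ℝ) ≤ K := by exact_mod_cast hK
  have hk₀K : k₀ ≤ K := Nat.ceil_le.2 ((Real.rpow_le_rpow_of_exponent_le hK' hγ.2).trans_eq
    (Real.rpow_one _))
  have hk₀K' : (k₀ : ℝ) ≤ K := by exact_mod_cast hk₀K
  have hrest : 0 ≤ (H : ℝ) * (K - k₀) := mul_nonneg (by positivity) (sub_nonneg.2 hk₀K')
  have hresidual : 2 * (H : ℝ) ^ 2 * (K - k₀) * deltaK S A H sch μ α γ K =
      H * (K - k₀) * (2 * H * deltaK S A H sch μ α γ K) := by ring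
  rw [hresidual]
  have hHk₀ : (0 : ℝ) ≤ H * k₀ := by positivity
  by_cases hopt : ∀ h s a, a ∈ M.optActions h s
  · rw [expectedRegret_eq_zero hπs hopt]
    positivity
  have hne : ∃ h s a, a ∉ M.optActions h s := by simpa using hopt
  have hgpos := gap_pos hπs hne
  have hgH := gap_le_horizon hπs hne
  have hS : 1 ≤ Fintype.card S := Fintype.card_pos_iff.2 ⟨M.s0⟩
  have hA : 1 ≤ Fintype.card A := Fintype.card_pos
  have htriv := expectedRegret_le_mul (M := M) (πs := πs) L K
  -- If `2 H δ_K ≥ 1`, the last two terms already exceed the trivial bound `H K`.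
  rcases le_or_gt 1 (2 * H * deltaK S A H sch μ α γ K) with hδ | hδ
  · have := mul_le_mul_of_nonneg_left hδ hrest
    linarith
  have hres0 : 0 ≤ (H : ℝ) * (K - k₀) * (2 * H * deltaK S A H sch μ α γ K) := by positivity
  have hlog := log_le_of_deltaK_lt hH hS hA hK hμ.le hα.1 hγ.2 hδ
  have hlog2 := Real.log_two_gt_d9
  rcases le_or_gt K 8 with hK8 | hK8
  -- Here `16 K ≥ 2 ^ 4`, so `mK ≥ 16 H ln 2 ≥ 8 H ≥ H K`.
  · have h16 : 4 * Real.log 2 ≤ Real.log (16 * K) := by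
      rw [show (4 : ℝ) * Real.log 2 = Real.log (2 ^ 4) by rw [Real.log_pow]; norm_num]
      exact Real.log_le_log (by norm_num) (by linarith)
    have hm := mul_le_mK hH hS hA hgpos hgH (by linarith) (h16.trans hlog)
    have : (H : ℝ) * K ≤ H * (16 * Real.log 2) := by
      refine mul_le_mul_of_nonneg_left ?_ (by positivity)
      have : (K : ℝ) ≤ 8 := by exact_mod_cast hK8
      linarith
    linarith
  -- Here `16 K ≥ 2 ^ 7`, so `c ≥ 3.5 ln 2 > 9 / 4`, as needed to absorb the first visits.
  have h128 : 7 * Real.log 2 ≤ Real.log (16 * K) := by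
    rw [show (7 : ℝ) * Real.log 2 = Real.log (2 ^ 7) by rw [Real.log_pow]; norm_num]
    have : (8 : ℝ) ≤ K := by exact_mod_cast hK8.le
    exact Real.log_le_log (by norm_num) (by linarith)
  set c := 0.5 * (Fintype.card S : ℝ) * Real.log 2 + μ * (K : ℝ) ^ α with hc
  have hc94 : (3 / 2) ^ 2 ≤ c := by
    have : 2 * c = Fintype.card S * Real.log 2 + 2 * μ * (K : ℝ) ^ α := by rw [hc]; ring
    linarith
  have hsqrt : 3 / 2 ≤ √c := Real.le_sqrt_of_sq_le hc94
  have hε : M.gap πs / (2 * H) ≤ 2 * √c := by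
    rw [div_le_iff₀ (by positivity)]
    nlinarith
  have hmain := expectedRegret_le_clipped hπs hμ.le hα.1 hL hk₀K (Nat.le_ceil _)
    (sum_clip_surplus_le (by positivity) hε (by linarith))
  have hcost := sum_clip_bound_le_mK (M := M) (πs := πs) hH rfl hc hsqrt hgpos
  have hslack : (H : ℝ) * (K - k₀) * deltaK S A H sch μ α γ K ≤
      H * (K - k₀) * (2 * H * deltaK S A H sch μ α γ K) :=
    mul_le_mul_of_nonneg_left (le_mul_of_one_le_left hδ0 (by linarith)) hrest
  exact hmain.trans (add_le_add (add_le_add hcost le_rfl) hslack)
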